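/- Let $U$ be a finite set with a fixed linear order. A function $f:2^U\to\mathbb R$ is submodular if $f(S\cup T)+f(S\cap T)\le f(S)+f(T)$ for all $S,T\subseteq U$; write $\partial_xg(S)=g(S\cup\{x\})-g(S)$. A product distribution $\mathcal D$ on $2^U$ contains each $x$ independently with probability $p_x\in[0,1]$. A (fixed) oracle for $f$ of tolerance $\tau$ is a function $\tilde f:2^U\to\mathbb R$ with $|\tilde f(S)-f(S)|\le\tau$ for all $S$. A function $h$ $(\alpha,\beta)$-approximates $f$ over $\mathcal D$ if $\Pr_{S\sim\mathcal D}\{|f(S)-h(S)|\le\alpha\}\ge 1-\beta$. Logarithms are natural. **The algorithm.** The input is $\alpha,\beta,\delta\in(0,1]$, the marginals $(p_x)$, and oracle access to $\tilde f$. Put $\gamma=\alpha^2/(6\log(2/\beta))$. *Decomposition.* For a function $g$ on the subsets of an ordered set $X$: start with $\mathcal I=\{\emptyset\}$; for $x\in X$ in ascending order, add $B\cup\{x\}$ to $\mathcal I$ for each $B$ that was in $\mathcal I$ and has $\partial_xg(B)>\gamma/3$. For $B\in\mathcal I$ let $V(B)=\{x\in X:\partial_xg(B)\le 2\gamma/3\}$.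 For $S\subseteq X$ let $F(S)$ be the set obtained from $\emptyset$ by scanning $X$ in ascending order and adding $x$ to the current set $B'$ whenever $x\in S$ and $\partial_xg(B')>\gamma/3$. Let $T(B)$ be the set of all $x\notin B$ that satisfy $\partial_xg(B')>\gamma/3$ when they are met in the scan for $S=B$. *Two stages.* Decompose $\tilde f$ on $U$; this gives $\mathcal I_f,V_f,T_f,F_f$. For each $B\in\mathcal I_f$ decompose $S\mapsto\tilde f((V_f(B)\setminus S)\cup B)$ on $V_f(B)$; this gives $\mathcal I_B,V_B,T_B,F_B$. The pair of $S\subseteq U$ is $F(S)=(B,C)$ with $B=F_f(S)$ and $C=F_B(V_f(B)\setminus S)$. *Averaging.* Let $N$ be the number of pairs $(B,C)$ with $B\in\mathcal I_f$, $C\in\mathcal I_B$, and let $m=\lceil 1250\,\alpha^{-2}\log(2N/\delta)\rceil$. For each pair draw $m$ independent samples $R$ from $\mathcal D$ restricted to $(V_f(B)\cap V_B(C))\setminus(T_f(B)\cup T_B(C))$, and let $\mu_{B,C}$ be the average of the oracle's answers at $((R\cup T_B(C))\setminus C)\cup B$. The output is a data structure $h$ made of the sets and the values computed above; $h(S)=\mu_{F(S)}$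 is evaluated from it without further queries. Time is counted in a unit-cost model: comparisons and arithmetic operations on reals, oracle queries, and tosses of a coin of given bias cost one step each; an operation on subsets of $U$ costs $|U|+1$ steps. **Theorem.** There is a universal constant $K>0$ such that the following holds for all $\alpha,\beta,\delta\in(0,1]$, every finite ordered set $U$, every product distribution $\mathcal D$ on $2^U$, every submodular $f:2^U\to[0,1]$ and every oracle for $f$ of tolerance $\alpha^2/(72\log(2/\beta))$. 1. With probability at least $1-\delta$ over the coins of the algorithm, its output $h$ $(\alpha,\beta)$-approximates $f$ over $\mathcal D$. 2. If $|U|\ge2$, then for all outcomes of the coins the algorithm takes at most $|U|^{K\alpha^{-2}\log(2/\beta)}\,(1+\log(1/\delta))$ steps, and for every $S\subseteq U$ evaluating $h(S)$ takes at most $|U|^{K\alpha^{-2}\log(2/\beta)}$ steps. -/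

import Mathlib

/-! ### Submodular functions, product distributions -/

/-- `f (S ∪ T) + f (S ∩ T) ≤ f S + f T` for all sets `S`, `T`. -/
def IsSubmodular {U : Type} [DecidableEq U] (f : Finset U → ℝ) : Prop :=
  ∀ S T : Finset U, f (S ∪ T) + f (S ∩ T) ≤ f S + f T

/-- The probability of the set `S` under the product distribution on subsets of `U` that contains
each `x` independently with probability `p x`. -/
noncomputable def productWeight {U : Type} [Fintype U] [DecidableEq U]
    (p : U → unitInterval) (S : Finset U) : ℝ :=
  (∏ x ∈ S, (p x : ℝ)) * ∏ x ∈ Sᶜ, (1 - (p x : ℝ))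

open Classical in
/-- The probability of the event `E` under the product distribution with marginals `p`. -/
noncomputable def productProb {U : Type} [Fintype U] [DecidableEq U]
    (p : U → unitInterval) (E : Finset U → Prop) : ℝ :=
  ∑ S : Finset U, if E S then productWeight p S else 0

/-- `h` approximates `f` up to `α`, except with probability at most `β` over the product
distribution with marginals `p`. -/
def Approximates {U : Type} [Fintype U] [DecidableEq U] (α β : ℝ)
    (p : U → unitInterval) (f h : Finset U → ℝ) : Prop :=
  1 - β ≤ productProb p (fun S => |f S - h S| ≤ α)

/-! ### Programs with step counts

Computations are unit-cost: a comparison or an arithmetic operation on real numbers, an oracle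
query and a toss of a coin of given bias cost one step each, while an operation on subsets of `U`
(union, difference, insertion, equality test, ...), which are stored as bit vectors, costs
`|U| + 1` steps. -/

/-- A randomized computation with oracle access to a function on the subsets of `U`. -/
inductive Prog (U : Type) (A : Type) : Type
  /-- stop with the result `a` -/
  | ret (a : A) : Prog U A
  /-- spend `n` elementary steps -/
  | work (n : ℕ) (next : Prog U A) : Prog U A
  /-- ask the oracle for its value at `S` -/
  | query (S : Finset U) (next : ℝ → Prog U A) : Prog U A
  /-- toss a coin that shows `true` with probability `q` -/
  | toss (q : unitInterval) (next : Bool → Prog U A) : Prog U A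

namespace Prog

variable {U A B : Type}

/-- Sequential composition. -/
def andThen : Prog U A → (A → Prog U B) → Prog U B
  | ret a, c => c a
  | work n next, c => work n (andThen next c)
  | query S next, c => query S (fun r => andThen (next r) c)
  | toss q next, c => toss q (fun b => andThen (next b) c)

instance : Monad (Prog U) where
  pure := ret
  bind := andThen

/-- The largest number of steps, over all outcomes of the coins, of a run with the oracle `O`. -/
noncomputable def time (O : Finset U → ℝ) : Prog U A → ℕ
  | ret _ => 0
  | work n next => n + time O next
  | query S next => 1 + time O (next (O S))
  | toss _ next => 1 + max (time O (next true)) (time O (next false))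

open Classical in
/-- The probability, over the (independent) coins, that a run with the oracle `O` returns a result
in `E`. -/
noncomputable def prob (O : Finset U → ℝ) (E : A → Prop) : Prog U A → ℝ
  | ret a => if E a then 1 else 0
  | work _ next => prob O E next
  | query S next => prob O E (next (O S))
  | toss q next => (q : ℝ) * prob O E (next true) + (1 - (q : ℝ)) * prob O E (next false)

/-- `a` is the result of a run with the oracle `O` for some outcome of the coins. -/
def CanReturn (O : Finset U → ℝ) (a : A) : Prog U A → Prop
  | ret a' => a' = a
  | work _ next => CanReturn O a next
  | query S next => CanReturn O a (next (O S))
  | toss _ next => CanReturn O a (next true) ∨ CanReturn O a (next false)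

/-- One arithmetic operation with result `a`. -/
def arith (a : A) : Prog U A := work 1 (ret a)

/-- One operation on subsets of `U` with result `a`. -/
def setOp [Fintype U] (a : A) : Prog U A := work (Fintype.card U + 1) (ret a)

/-- The oracle's value at `S`. -/
def ask (S : Finset U) : Prog U ℝ := query S ret

end Prog

/-- A deterministic computation without oracle: its result and its number of steps. -/
structure Timed (A : Type) : Type where
  val : A
  cost : ℕ

instance : Monad Timed where
  pure a := ⟨a, 0⟩
  bind t c := ⟨(c t.val).val, t.cost + (c t.val).cost⟩

/-! ### The decomposition

In this section `probe` computes the value, at a given set, of the function that is decomposed, and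
`xs` lists the ground set of that function in ascending order. -/

/-- A set `base` of the family that the decomposition enumerates, with the set `dom` of all
elements whose marginal at `base` is at most `2 γ / 3`, the set `low` of those whose marginal at
`base` is at most `γ / 3`, and the set `rej` of the elements that are rejected on the path to
`base`. -/
structure Piece (U : Type) : Type where
  base : Finset U
  dom : Finset U
  low : Finset U
  rej : Finset U

section Decomposition

variable {U : Type} [Fintype U] [LinearOrder U]

/-- The ground set in ascending order. -/
def universeList (U : Type) [Fintype U] [LinearOrder U] : List U :=
  (Finset.univ : Finset U).sort

/-- The marginal value of `x` at `B`. -/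
def marginal (probe : Finset U → Prog U ℝ) (x : U) (B : Finset U) : Prog U ℝ := do
  let B' ← Prog.setOp (insert x B)
  let a ← probe B'
  let b ← probe B
  Prog.arith (a - b)

/-- The family of sets: start with the empty set only; for each `x` in ascending order and each
set `B` found so far, add `B ∪ {x}` if the marginal value of `x` at `B` exceeds `γ / 3`. -/
noncomputable def enumerate (probe : Finset U → Prog U ℝ) (γ : ℝ) (xs : List U) :
    Prog U (List (Finset U)) :=
  xs.foldlM (fun I x => do
    let I' ← I.foldlM (fun I' B => do
      let d ← marginal probe x B
      let high ← Prog.arith (decide (γ / 3 < d))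
      if high then do
        let B' ← Prog.setOp (insert x B)
        Prog.arith (B' :: I')
      else
        pure I') []
    Prog.work (I.length + I'.length + 1) (pure (I ++ I'))) [∅]

/-- The set of elements whose marginal value at `B` is at most `θ`. -/
noncomputable def smallMarginals (probe : Finset U → Prog U ℝ) (θ : ℝ) (xs : List U)
    (B : Finset U) : Prog U (Finset U) :=
  xs.foldlM (fun V x => do
    let d ← marginal probe x B
    let small ← Prog.arith (decide (d ≤ θ))
    if small then Prog.setOp (insert x V) else pure V) ∅

/-- The elements that are rejected on the path to `B`: scan the ground set in ascending order
with a current set, at first empty. An element of marginal value more than `γ / 3` at the current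
set is added to it if it lies in `B`, and is rejected otherwise. -/
noncomputable def rejected (probe : Finset U → Prog U ℝ) (γ : ℝ) (xs : List U)
    (B : Finset U) : Prog U (Finset U) := do
  let s ← xs.foldlM (fun (s : Finset U × Finset U) x => do
    let d ← marginal probe x s.1
    let high ← Prog.arith (decide (γ / 3 < d))
    if high then do
      let mem ← Prog.arith (decide (x ∈ B))
      if mem then do
        let C ← Prog.setOp (insert x s.1)
        pure (C, s.2)
      else do
        let R ← Prog.setOp (insert x s.2)
        pure (s.1, R)
    else
      pure s) (∅, ∅)
  pure s.2

/-- The decomposition for functions with few large positive marginals. -/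
noncomputable def decompose (probe : Finset U → Prog U ℝ) (γ : ℝ) (xs : List U) :
    Prog U (List (Piece U)) := do
  let I ← enumerate probe γ xs
  I.mapM (fun B => do
    let V ← smallMarginals probe (2 * γ / 3) xs B
    let L ← smallMarginals probe (γ / 3) xs B
    let T ← rejected probe γ xs B
    Prog.arith { base := B, dom := V, low := L, rej := T })

/-- The second stage of the decomposition, for the piece `P` of the first stage: decompose
`S ↦ f ((P.dom \ S) ∪ P.base)` on the ground set `P.dom`. -/
noncomputable def decomposeComplement (γ : ℝ) (P : Piece U) : Prog U (List (Piece U)) := do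
  let xs ← Prog.work (Fintype.card U + 1) (pure ((universeList U).filter (fun x => x ∈ P.dom)))
  decompose (fun S => do
    let S' ← Prog.setOp ((P.dom \ S) ∪ P.base)
    Prog.ask S') γ xs

/-- The two-stage decomposition. -/
noncomputable def decomposeTwice (U : Type) [Fintype U] [LinearOrder U] (γ : ℝ) :
    Prog U (List (Piece U × List (Piece U))) := do
  let Ps ← decompose Prog.ask γ (universeList U)
  Ps.mapM (fun P => do
    let Qs ← decomposeComplement γ P
    Prog.arith (P, Qs))

end Decomposition

/-! ### The learning algorithm -/

/-- The output of the learning algorithm: the pieces `P` of the first stage, each with its pieces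
`Q` of the second stage and the estimates for the pairs `(P, Q)`. -/
abbrev Hypothesis (U : Type) : Type := List (Piece U × List (Piece U × ℝ))

section Learning

variable {U : Type} [Fintype U] [LinearOrder U]

/-- Draw a random subset of `W` from the product distribution with marginals `p`. -/
def sampleSubset (p : U → unitInterval) (W : Finset U) : Prog U (Finset U) :=
  (universeList U).foldlM (fun R x => do
    let mem ← Prog.arith (decide (x ∈ W))
    if mem then do
      let b ← Prog.toss (p x) Prog.ret
      if b then Prog.setOp (insert x R) else pure R
    else
      pure R) ∅

/-- Estimate, by the average over `m` independent samples, the mean of the function that belongs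
to the pair `(P, Q)`, which is `f` with the elements of `P.base` forced into its argument and those
of `Q.base` forced out of it. The elements of `Q.rej` are put into the argument, the elements of
`(P.dom ∩ Q.dom) \ (P.rej ∪ Q.rej)` are sampled, and all other elements are left out. -/
noncomputable def estimate (p : U → unitInterval) (m : ℕ) (P Q : Piece U) : Prog U ℝ := do
  let W₁ ← Prog.setOp (P.dom ∩ Q.dom)
  let W₂ ← Prog.setOp (P.rej ∪ Q.rej)
  let W ← Prog.setOp (W₁ \ W₂)
  let total ← (List.range m).foldlM (fun (acc : ℝ) _ => do
    let R ← sampleSubset p W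
    let S₁ ← Prog.setOp (R ∪ Q.rej)
    let S₂ ← Prog.setOp (S₁ \ Q.base)
    let S ← Prog.setOp (S₂ ∪ P.base)
    let v ← Prog.ask S
    Prog.arith (acc + v)) 0
  Prog.arith (total / m)

/-- The learning algorithm: decompose with parameter `γ = α ^ 2 / (6 log (2 / β))`, and estimate
the mean for each of the `N` pairs of pieces from `⌈1250 α⁻² log (2 N / δ)⌉` samples. -/
noncomputable def learn (p : U → unitInterval) (α β δ : ℝ) : Prog U (Hypothesis U) := do
  let γ ← Prog.arith (α ^ 2 / (6 * Real.log (2 / β)))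
  let G ← decomposeTwice U γ
  let N ← (pure (G.map (fun e => e.2.length)).sum : Prog U ℕ)
  let _ ← Prog.work (G.length + N + 1) (pure ())
  let m ← Prog.arith ⌈1250 / α ^ 2 * Real.log (2 * N / δ)⌉₊
  G.mapM (fun e => do
    let table ← e.2.mapM (fun Q => do
      let v ← estimate p m e.1 Q
      Prog.arith (Q, v))
    Prog.arith (e.1, table))

/-! ### Evaluation of the output -/

/-- Search a table for the entry of the piece with base `B`. -/
def lookup {A : Type} (table : List (Piece U × A)) (B : Finset U) :
    Timed (Option (Piece U × A)) :=
  ⟨table.find? (fun e => e.1.base = B), (table.length + 1) * (Fintype.card U + 1)⟩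

/-- The base of the piece to which `S` belongs: scan the ground set in ascending order with a
current set, at first empty; add an element of `S` if its marginal value at the current set exceeds
`γ / 3`. -/
def locate {A : Type} (table : List (Piece U × A)) (xs : List U) (S : Finset U) :
    Timed (Finset U) :=
  xs.foldlM (fun B x => do
    let e ← lookup table B
    match e with
    | none => pure B
    | some (P, _) =>
      if x ∈ S ∧ x ∉ P.low then Timed.mk (insert x B) (Fintype.card U + 3)
      else Timed.mk B 2) ∅

/-- The value of a hypothesis at `S`: find the piece `P` of `S` in the first stage, then the piece
`Q` of `P.dom \ S` in the second stage, and answer with the estimate for `(P, Q)`. -/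
noncomputable def Hypothesis.eval (h : Hypothesis U) (S : Finset U) : Timed ℝ := do
  let B ← locate h (universeList U) S
  let e ← lookup h B
  match e with
  | none => Timed.mk 0 1
  | some (P, table) => do
    let xs ← Timed.mk ((universeList U).filter (fun x => x ∈ P.dom)) (Fintype.card U + 1)
    let S' ← Timed.mk (P.dom \ S) (Fintype.card U + 1)
    let C ← locate table xs S'
    let e' ← lookup table C
    match e' with
    | none => Timed.mk 0 1
    | some (_, v) => Timed.mk v 1

end Learning

set_option linter.unusedSectionVars false

/-! ### Random subsets of a list -/

section RandomSubset

variable {U : Type} [DecidableEq U]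

/-- The expectation of `φ (S ∪ R)`, where `R` contains each `x` of the list independently with
probability `q x`. -/
def seqExp (q : U → ℝ) : List U → (Finset U → ℝ) → Finset U → ℝ
  | [], φ, S => φ S
  | x :: l, φ, S => q x * seqExp q l φ (insert x S) + (1 - q x) * seqExp q l φ S

theorem seqExp_const (q : U → ℝ) (l : List U) (c : ℝ) (S : Finset U) :
    seqExp q l (fun _ => c) S = c := by
  induction l generalizing S with
  | nil => rfl
  | cons x l ih => simp only [seqExp, ih]; ring

theorem seqExp_add (q : U → ℝ) (l : List U) (φ ψ : Finset U → ℝ) (S : Finset U) :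
    seqExp q l (fun T => φ T + ψ T) S = seqExp q l φ S + seqExp q l ψ S := by
  induction l generalizing S with
  | nil => rfl
  | cons x l ih => simp only [seqExp, ih]; ring

theorem seqExp_mul_left (q : U → ℝ) (l : List U) (c : ℝ) (φ : Finset U → ℝ) (S : Finset U) :
    seqExp q l (fun T => c * φ T) S = c * seqExp q l φ S := by
  induction l generalizing S with
  | nil => rfl
  | cons x l ih => simp only [seqExp, ih]; ring

theorem seqExp_sub (q : U → ℝ) (l : List U) (φ ψ : Finset U → ℝ) (S : Finset U) :
    seqExp q l (fun T => φ T - ψ T) S = seqExp q l φ S - seqExp q l ψ S := by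
  induction l generalizing S with
  | nil => rfl
  | cons x l ih => simp only [seqExp, ih]; ring

theorem seqExp_insert (q : U → ℝ) (l : List U) (φ : Finset U → ℝ) (x : U) (S : Finset U) :
    seqExp q l (fun T => φ (insert x T)) S = seqExp q l φ (insert x S) := by
  induction l generalizing S with
  | nil => rfl
  | cons y l ih => simp only [seqExp, ih, Finset.insert_comm x y]

theorem seqExp_congr_marginals {q q' : U → ℝ} {l : List U} (h : ∀ x ∈ l, q x = q' x)
    (φ : Finset U → ℝ) (S : Finset U) : seqExp q l φ S = seqExp q' l φ S := by
  induction l generalizing S with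
  | nil => rfl
  | cons y l ih =>
    simp only [seqExp, h y List.mem_cons_self, ih fun x hx => h x (List.mem_cons_of_mem _ hx)]

theorem seqExp_mono {q : U → ℝ} (hq : ∀ x, 0 ≤ q x ∧ q x ≤ 1) {l : List U} {φ ψ : Finset U → ℝ}
    {S : Finset U} (h : ∀ T, S ⊆ T → T ⊆ S ∪ l.toFinset → φ T ≤ ψ T) :
    seqExp q l φ S ≤ seqExp q l ψ S := by
  induction l generalizing S with
  | nil => exact h S subset_rfl (by simp)
  | cons x l ih =>
    have h1 : seqExp q l φ (insert x S) ≤ seqExp q l ψ (insert x S) := by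
      refine ih fun T hT hT' => h T ((Finset.subset_insert _ _).trans hT) (hT'.trans ?_)
      intro y hy; simp at hy ⊢; tauto
    have h0 : seqExp q l φ S ≤ seqExp q l ψ S := by
      refine ih fun T hT hT' => h T hT (hT'.trans ?_)
      intro y hy; simp at hy ⊢; tauto
    have := hq x
    simp only [seqExp]
    exact add_le_add (mul_le_mul_of_nonneg_left h1 this.1)
      (mul_le_mul_of_nonneg_left h0 (by linarith))

theorem seqExp_congr {q : U → ℝ} (hq : ∀ x, 0 ≤ q x ∧ q x ≤ 1) {l : List U}
    {φ ψ : Finset U → ℝ} {S : Finset U}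
    (h : ∀ T, S ⊆ T → T ⊆ S ∪ l.toFinset → φ T = ψ T) :
    seqExp q l φ S = seqExp q l ψ S :=
  le_antisymm (seqExp_mono hq fun T h1 h2 => (h T h1 h2).le)
    (seqExp_mono hq fun T h1 h2 => (h T h1 h2).ge)

theorem seqExp_nonneg {q : U → ℝ} (hq : ∀ x, 0 ≤ q x ∧ q x ≤ 1) {l : List U}
    {φ : Finset U → ℝ} (h : ∀ T, 0 ≤ φ T) (S : Finset U) : 0 ≤ seqExp q l φ S := by
  have := seqExp_mono hq (l := l) (S := S) (φ := fun _ => 0) (ψ := φ) fun T _ _ => h T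
  rwa [seqExp_const] at this

theorem seqExp_sum {ι : Type} (s : Finset ι) (q : U → ℝ) (l : List U) (φ : ι → Finset U → ℝ)
    (S : Finset U) : seqExp q l (fun T => ∑ i ∈ s, φ i T) S = ∑ i ∈ s, seqExp q l (φ i) S := by
  induction l generalizing S with
  | nil => rfl
  | cons x l ih => simp only [seqExp, ih, Finset.sum_add_distrib, Finset.mul_sum]

theorem seqExp_append (q : U → ℝ) (l l' : List U) (φ : Finset U → ℝ) (S : Finset U) :
    seqExp q (l ++ l') φ S = seqExp q l (seqExp q l' φ) S := by
  induction l generalizing S with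
  | nil => rfl
  | cons x l ih => simp only [seqExp, List.cons_append, ih]

theorem seqExp_perm (q : U → ℝ) {l l' : List U} (h : l.Perm l') (φ : Finset U → ℝ)
    (S : Finset U) : seqExp q l φ S = seqExp q l' φ S := by
  induction h generalizing S with
  | nil => rfl
  | cons x _ ih => simp only [seqExp, ih]
  | swap x y l => simp only [seqExp, Finset.insert_comm x y]; ring
  | trans _ _ ih1 ih2 => rw [ih1, ih2]

/-- A function that decreases when elements other than `x` are added has a smaller expectation
when the marginals and the starting set are larger. -/
theorem seqExp_antitone {q q' : U → ℝ} (hq : ∀ x, 0 ≤ q x) (hqq : ∀ x, q x ≤ q' x)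
    (hq' : ∀ x, q' x ≤ 1) {x : U} {g : Finset U → ℝ}
    (hg : ∀ S T, S ⊆ T → x ∉ T → g T ≤ g S) {l : List U} (hx : x ∉ l) {S S' : Finset U}
    (hS : S ⊆ S') (hxS : x ∉ S') : seqExp q' l g S' ≤ seqExp q l g S := by
  induction l generalizing S S' with
  | nil => exact hg _ _ hS hxS
  | cons y l ih =>
    rw [List.mem_cons, not_or] at hx
    have h1 := ih hx.2 (Finset.insert_subset_insert y hS) (by simp [hx.1, hxS])
    have h0 := ih hx.2 hS hxS
    have h10 := ih (S := S) (S' := insert y S) hx.2 (Finset.subset_insert _ _)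
      (by simp [hx.1]; exact fun h => hxS (hS h))
    have hself : seqExp q l g (insert y S) ≤ seqExp q l g S := by
      clear h1 h0 h10
      have hxS' : x ∉ insert y S := by simp [hx.1]; exact fun h => hxS (hS h)
      have : ∀ l : List U, x ∉ l → ∀ S S' : Finset U, S ⊆ S' → x ∉ S' →
          seqExp q l g S' ≤ seqExp q l g S := by
        intro l
        induction l with
        | nil => exact fun _ _ _ h h' => hg _ _ h h'
        | cons z l ih =>
          intro hz S S' h h'
          rw [List.mem_cons, not_or] at hz
          have h1 := ih hz.2 _ _ (Finset.insert_subset_insert z h) (by simp [hz.1, h'])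
          have h0 := ih hz.2 _ _ h h'
          exact add_le_add (mul_le_mul_of_nonneg_left h1 (hq z))
            (mul_le_mul_of_nonneg_left h0 (by linarith [hqq z, hq' z]))
      exact this l hx.2 _ _ (Finset.subset_insert _ _) hxS'
    simp only [seqExp]
    have e1 := mul_le_mul_of_nonneg_left h1 ((hq y).trans (hqq y))
    have e0 := mul_le_mul_of_nonneg_left h0 (sub_nonneg.2 (hq' y))
    have e2 := mul_le_mul_of_nonneg_left hself (sub_nonneg.2 (hqq y))
    linarith

theorem IsSubmodular.marginal_le {f : Finset U → ℝ} (hf : IsSubmodular f) {x : U}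
    {S T : Finset U} (h : S ⊆ T) (hx : x ∉ T) :
    f (insert x T) - f T ≤ f (insert x S) - f S := by
  have := hf (insert x S) T
  rw [Finset.insert_union, Finset.union_eq_right.2 h, Finset.insert_inter_of_notMem hx,
    Finset.inter_eq_left.2 h] at this
  linarith

/-! ### Concentration of submodular functions -/

theorem exp_le_quadratic {u : ℝ} (hu : |u| ≤ 1) : Real.exp u ≤ 1 + u + 3 / 4 * u ^ 2 := by
  have := Real.exp_bound hu (n := 2) (by norm_num)
  simp [Finset.sum_range_succ, Nat.factorial] at this
  have := (abs_le.1 this).2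
  linarith

/-- The moment generating function of a random variable with two values. -/
theorem two_point_exp_le {p a b s : ℝ} (hp : 0 ≤ p) (hp1 : p ≤ 1) (h : |s * (a - b)| ≤ 1) :
    p * Real.exp (s * a) + (1 - p) * Real.exp (s * b) ≤
      Real.exp (s * (p * a + (1 - p) * b) + 3 / 4 * s ^ 2 * (p * (1 - p) * (a - b) ^ 2)) := by
  have ha : Real.exp (s * a) = Real.exp (s * (p * a + (1 - p) * b)) *
      Real.exp ((1 - p) * (s * (a - b))) := by rw [← Real.exp_add]; congr 1; ring
  have hb : Real.exp (s * b) = Real.exp (s * (p * a + (1 - p) * b)) *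
      Real.exp (-p * (s * (a - b))) := by rw [← Real.exp_add]; congr 1; ring
  have h1 := exp_le_quadratic (u := (1 - p) * (s * (a - b))) (by
    rw [abs_mul]
    exact mul_le_one₀ (abs_le.2 ⟨by linarith, by linarith⟩) (abs_nonneg _) h)
  have h2 := exp_le_quadratic (u := -p * (s * (a - b))) (by
    rw [abs_mul]
    exact mul_le_one₀ (abs_le.2 ⟨by linarith, by linarith⟩) (abs_nonneg _) h)
  rw [ha, hb, Real.exp_add]
  have h3 := Real.add_one_le_exp (3 / 4 * s ^ 2 * (p * (1 - p) * (a - b) ^ 2))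
  have e1 := mul_le_mul_of_nonneg_left h1 hp
  have e2 := mul_le_mul_of_nonneg_left h2 (sub_nonneg.2 hp1)
  calc _ = Real.exp (s * (p * a + (1 - p) * b)) * (p * Real.exp ((1 - p) * (s * (a - b))) +
        (1 - p) * Real.exp (-p * (s * (a - b)))) := by ring
    _ ≤ _ := by
      refine mul_le_mul_of_nonneg_left ?_ (Real.exp_pos _).le
      nlinarith

/-- An exponential moment bound for a submodular function whose marginal values lie in `[-c, c]`;
`a` and `b` bound its increase along random subsets and its decrease along random supersets. -/
theorem seqExp_exp_le {f : Finset U → ℝ} (hf : IsSubmodular f) {p : U → ℝ}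
    (hp : ∀ x, 0 ≤ p x ∧ p x ≤ 1) {c s : ℝ} (hc : 0 ≤ c) (hs : |s| * c ≤ 1) {l : List U}
    (hl : l.Nodup) {S : Finset U} (hS : ∀ x ∈ l, x ∉ S)
    (hlip : ∀ x ∈ l, ∀ T, S ⊆ T → T ⊆ S ∪ l.toFinset → x ∉ T → |f (insert x T) - f T| ≤ c)
    {a b : ℝ}
    (ha : ∀ q : U → ℝ, (∀ x, 0 ≤ q x) → (∀ x, q x ≤ p x) → seqExp q l f S - f S ≤ a)
    (hb : ∀ q : U → ℝ, (∀ x, p x ≤ q x) → (∀ x, q x ≤ 1) →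
      seqExp q l f S - f (S ∪ l.toFinset) ≤ b) :
    seqExp p l (fun T => Real.exp (s * f T)) S ≤
      Real.exp (s * seqExp p l f S + 3 / 4 * s ^ 2 * (c * (a + b))) := by
  induction l generalizing S a b with
  | nil =>
    have h1 := ha p (fun x => (hp x).1) (fun _ => le_rfl)
    have h2 := hb p (fun _ => le_rfl) (fun x => (hp x).2)
    simp only [seqExp, List.toFinset_nil, Finset.union_empty, sub_self] at h1 h2
    simp only [seqExp]
    refine Real.exp_le_exp.2 ?_
    have : 0 ≤ 3 / 4 * s ^ 2 * (c * (a + b)) := by positivity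
    linarith
  | cons x l ih =>
    obtain ⟨hxl, hl⟩ := List.nodup_cons.1 hl
    have hxS : x ∉ S := hS x List.mem_cons_self
    have hxSl : x ∉ S ∪ l.toFinset := by simp [hxS, hxl]
    have htop : S ∪ (x :: l).toFinset = insert x (S ∪ l.toFinset) := by
      ext y; simp
    have htop' : insert x S ∪ l.toFinset = insert x (S ∪ l.toFinset) := by
      ext y; simp
    have hpx := hp x
    have hanti : ∀ S T, S ⊆ T → x ∉ T → f (insert x T) - f T ≤ f (insert x S) - f S :=
      fun S T h h' => hf.marginal_le h h'
    have hD : ∀ q, seqExp q l (fun T => f (insert x T) - f T) S =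
        seqExp q l f (insert x S) - seqExp q l f S := by
      intro q; rw [seqExp_sub, seqExp_insert]
    set Δ := seqExp p l f (insert x S) - seqExp p l f S with hΔ
    have hΔc : |Δ| ≤ c := by
      rw [hΔ, ← hD]
      have hb' : ∀ T, S ⊆ T → T ⊆ S ∪ l.toFinset → |f (insert x T) - f T| ≤ c := by
        intro T h1 h2
        refine hlip x List.mem_cons_self T h1 (h2.trans ?_) fun h => hxSl (h2 h)
        rw [htop]; exact Finset.subset_insert _ _
      rw [abs_le]
      constructor
      · have := seqExp_mono hp (l := l) (S := S) (φ := fun _ => -c)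
          (ψ := fun T => f (insert x T) - f T) fun T h1 h2 => (abs_le.1 (hb' T h1 h2)).1
        rwa [seqExp_const] at this
      · have := seqExp_mono hp (l := l) (S := S) (ψ := fun _ => c)
          (φ := fun T => f (insert x T) - f T) fun T h1 h2 => (abs_le.1 (hb' T h1 h2)).2
        rwa [seqExp_const] at this
    have hupd : ∀ (q : U → ℝ) (v : ℝ), seqExp (Function.update q x v) (x :: l) f S =
        v * seqExp q l f (insert x S) + (1 - v) * seqExp q l f S := by
      intro q v
      have : ∀ T, seqExp (Function.update q x v) l f T = seqExp q l f T := by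
        refine fun T => seqExp_congr_marginals (fun y hy => ?_) f T
        rw [Function.update_of_ne]; rintro rfl; exact hxl hy
      simp only [seqExp, this, Function.update_self]
    have hA : ∀ q : U → ℝ, (∀ x, 0 ≤ q x) → (∀ x, q x ≤ p x) →
        seqExp q l f S - f S ≤ a - p x * max Δ 0 := by
      intro q h0 hqp
      have key : ∀ v, 0 ≤ v → v ≤ p x →
          v * seqExp q l f (insert x S) + (1 - v) * seqExp q l f S - f S ≤ a := by
        intro v hv hv'
        rw [← hupd]
        refine ha _ (fun y => ?_) (fun y => ?_)
        · rcases eq_or_ne y x with rfl | hy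
          · simpa using hv
          · simpa [hy] using h0 y
        · rcases eq_or_ne y x with rfl | hy
          · simpa using hv'
          · simpa [hy] using hqp y
      have hmono := seqExp_antitone h0 hqp (fun x => (hp x).2) hanti hxl
        (subset_refl S) hxS
      rw [hD, hD, ← hΔ] at hmono
      rcases le_total Δ 0 with h | h
      · rw [max_eq_right h]; have := key 0 le_rfl hpx.1; linarith
      · rw [max_eq_left h]
        have h1 := key (p x) hpx.1 le_rfl
        have h2 := mul_le_mul_of_nonneg_left hmono hpx.1
        linarith
    have hB : ∀ q : U → ℝ, (∀ x, p x ≤ q x) → (∀ x, q x ≤ 1) →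
        seqExp q l f (insert x S) - f (insert x (S ∪ l.toFinset)) ≤
          b - (1 - p x) * max (-Δ) 0 := by
      intro q hqp h1
      have key : ∀ v, p x ≤ v → v ≤ 1 →
          v * seqExp q l f (insert x S) + (1 - v) * seqExp q l f S -
            f (insert x (S ∪ l.toFinset)) ≤ b := by
        intro v hv hv'
        rw [← hupd, ← htop]
        refine hb _ (fun y => ?_) (fun y => ?_)
        · rcases eq_or_ne y x with rfl | hy
          · simpa using hv
          · simpa [hy] using hqp y
        · rcases eq_or_ne y x with rfl | hy
          · simpa using hv'
          · simpa [hy] using h1 y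
      have hmono := seqExp_antitone (fun x => (hp x).1) hqp h1 hanti hxl
        (subset_refl S) hxS
      rw [hD, hD, ← hΔ] at hmono
      rcases le_total Δ 0 with h | h
      · rw [max_eq_left (by linarith)]
        have h1 := key (p x) le_rfl hpx.2
        have h2 := mul_le_mul_of_nonneg_left hmono (sub_nonneg.2 hpx.2)
        linarith
      · rw [max_eq_right (by linarith)]; have := key 1 hpx.2 le_rfl; linarith
    set a' := a - p x * max Δ 0
    set b' := b - (1 - p x) * max (-Δ) 0
    have I1 : seqExp p l (fun T => Real.exp (s * f T)) (insert x S) ≤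
        Real.exp (s * seqExp p l f (insert x S) + 3 / 4 * s ^ 2 * (c * (a' + b'))) := by
      refine ih hl ?_ ?_ ?_ ?_
      · intro y hy; simp only [Finset.mem_insert, not_or]
        exact ⟨fun h => hxl (h ▸ hy), hS y (List.mem_cons_of_mem _ hy)⟩
      · intro y hy T h1 h2 h3
        refine hlip y (List.mem_cons_of_mem _ hy) T ((Finset.subset_insert _ _).trans h1)
          (h2.trans ?_) h3
        rw [htop, htop']
      · intro q h0 hqp
        refine le_trans ?_ (hA q h0 hqp)
        have := seqExp_mono (fun x => ⟨h0 x, (hqp x).trans (hp x).2⟩) (l := l) (S := S)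
          (φ := fun T => f (insert x T) - f T) (ψ := fun _ => f (insert x S) - f S)
          (fun T h1 h2 => hanti S T h1 fun h => hxSl (h2 h))
        rw [hD, seqExp_const] at this
        linarith
      · intro q hqp h1
        rw [htop']; exact hB q hqp h1
    have I0 : seqExp p l (fun T => Real.exp (s * f T)) S ≤
        Real.exp (s * seqExp p l f S + 3 / 4 * s ^ 2 * (c * (a' + b'))) := by
      refine ih hl ?_ ?_ hA ?_
      · exact fun y hy => hS y (List.mem_cons_of_mem _ hy)
      · intro y hy T h1 h2 h3
        refine hlip y (List.mem_cons_of_mem _ hy) T h1 (h2.trans ?_) h3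
        rw [htop]; exact Finset.subset_insert _ _
      · intro q hqp h1
        refine le_trans ?_ (hB q hqp h1)
        have := seqExp_mono (fun x => ⟨(hp x).1.trans (hqp x), h1 x⟩) (l := l) (S := S)
          (ψ := fun T => f (insert x T) - f T)
          (φ := fun _ => f (insert x (S ∪ l.toFinset)) - f (S ∪ l.toFinset))
          (fun T h1 h2 => hanti T _ h2 hxSl)
        rw [hD, seqExp_const] at this
        linarith
    have hsΔ : |s * Δ| ≤ 1 := by
      rw [abs_mul]
      exact (mul_le_mul_of_nonneg_left hΔc (abs_nonneg s)).trans hs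
    have htwo := two_point_exp_le (a := seqExp p l f (insert x S)) (b := seqExp p l f S)
      hpx.1 hpx.2 (by rw [← hΔ]; exact hsΔ)
    rw [← hΔ] at htwo
    have hvar : p x * (1 - p x) * Δ ^ 2 ≤
        c * (p x * max Δ 0 + (1 - p x) * max (-Δ) 0) := by
      have hp0 := hpx.1
      have hp1 : 0 ≤ 1 - p x := sub_nonneg.2 hpx.2
      rcases le_total Δ 0 with h | h
      · rw [max_eq_right h, max_eq_left (by linarith)]
        rw [abs_of_nonpos h] at hΔc
        have : (-Δ) * (-Δ) ≤ c * (-Δ) := mul_le_mul_of_nonneg_right hΔc (by linarith)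
        have h2 := mul_le_mul_of_nonneg_left this hp1
        have h3 : p x * ((1 - p x) * (-Δ * -Δ)) ≤ 1 * ((1 - p x) * (-Δ * -Δ)) :=
          mul_le_mul_of_nonneg_right hpx.2 (mul_nonneg hp1 (mul_self_nonneg _))
        linarith
      · rw [max_eq_left h, max_eq_right (by linarith)]
        rw [abs_of_nonneg h] at hΔc
        have : Δ * Δ ≤ c * Δ := mul_le_mul_of_nonneg_right hΔc h
        have h2 := mul_le_mul_of_nonneg_left this hp0
        have h3 : (1 - p x) * (p x * (Δ * Δ)) ≤ 1 * (p x * (Δ * Δ)) :=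
          mul_le_mul_of_nonneg_right (by linarith) (mul_nonneg hp0 (mul_self_nonneg _))
        linarith
    simp only [seqExp]
    rw [Real.exp_add] at I1 I0
    set M := Real.exp (3 / 4 * s ^ 2 * (c * (a' + b'))) with hM
    have e1 := mul_le_mul_of_nonneg_left I1 hpx.1
    have e0 := mul_le_mul_of_nonneg_left I0 (sub_nonneg.2 hpx.2)
    have e2 := mul_le_mul_of_nonneg_right htwo (Real.exp_pos (3 / 4 * s ^ 2 * (c * (a' + b')))).le
    rw [← Real.exp_add] at e2
    refine le_trans (by linarith) (e2.trans (Real.exp_le_exp.2 ?_))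
    have := mul_le_mul_of_nonneg_left hvar (by positivity : 0 ≤ 3 / 4 * s ^ 2)
    simp only [a', b']
    linarith

open Classical in
/-- Two-sided tail bound for a submodular function with values in `[0, 1]` and marginal values in
`[-c, c]`. -/
theorem seqExp_deviation_le {f : Finset U → ℝ} (hf : IsSubmodular f)
    (hf01 : ∀ S, f S ∈ Set.Icc (0 : ℝ) 1) {p : U → ℝ} (hp : ∀ x, 0 ≤ p x ∧ p x ≤ 1) {c t : ℝ}
    (hc : 0 < c) (ht : 0 ≤ t) (ht3 : t ≤ 3) {l : List U} (hl : l.Nodup) {S : Finset U}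
    (hS : ∀ x ∈ l, x ∉ S)
    (hlip : ∀ x ∈ l, ∀ T, S ⊆ T → T ⊆ S ∪ l.toFinset → x ∉ T → |f (insert x T) - f T| ≤ c) :
    seqExp p l (fun T => if |f T - seqExp p l f S| ≤ t then 0 else 1) S ≤
      2 * Real.exp (-(t ^ 2 / (6 * c))) := by
  set μ := seqExp p l f S
  have hmgf : ∀ s : ℝ, |s| * c ≤ 1 → seqExp p l (fun T => Real.exp (s * f T)) S ≤
      Real.exp (s * μ + 3 / 4 * s ^ 2 * (c * (1 + 1))) := by
    intro s hs
    have hle : ∀ q : U → ℝ, (∀ x, 0 ≤ q x ∧ q x ≤ 1) → seqExp q l f S ≤ 1 := by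
      intro q hq
      have := seqExp_mono hq (l := l) (S := S) (φ := f) (ψ := fun _ => 1)
        fun T _ _ => (hf01 T).2
      rwa [seqExp_const] at this
    refine seqExp_exp_le hf hp hc.le hs hl hS hlip (fun q h0 h1 => ?_) (fun q h0 h1 => ?_)
    · have := hle q fun x => ⟨h0 x, (h1 x).trans (hp x).2⟩
      linarith [(hf01 S).1]
    · have := hle q fun x => ⟨(hp x).1.trans (h0 x), h1 x⟩
      linarith [(hf01 (S ∪ l.toFinset)).1]
  set s := t / (3 * c) with hs
  have hs0 : 0 ≤ s := by positivity
  have hsc : s * c ≤ 1 := by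
    rw [hs]; field_simp; linarith
  have h1 := hmgf s (by rwa [abs_of_nonneg hs0])
  have h2 := hmgf (-s) (by rwa [abs_neg, abs_of_nonneg hs0])
  have key : seqExp p l (fun T => if |f T - μ| ≤ t then 0 else 1) S ≤
      seqExp p l (fun T => Real.exp (-s * (μ + t)) * Real.exp (s * f T) +
        Real.exp (s * (μ - t)) * Real.exp (-s * f T)) S := by
    refine seqExp_mono hp fun T _ _ => ?_
    rw [← Real.exp_add, ← Real.exp_add]
    split_ifs with h
    · positivity
    · rw [abs_le, not_and_or, not_le, not_le] at h
      rcases h with h | h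
      · have : 0 ≤ s * (μ - t) + -s * f T := by nlinarith
        linarith [Real.one_le_exp this, Real.exp_pos (-s * (μ + t) + s * f T)]
      · have : 0 ≤ -s * (μ + t) + s * f T := by nlinarith
        linarith [Real.one_le_exp this, Real.exp_pos (s * (μ - t) + -s * f T)]
  rw [seqExp_add, seqExp_mul_left, seqExp_mul_left] at key
  have e1 := mul_le_mul_of_nonneg_left h1 (Real.exp_pos (-s * (μ + t))).le
  have e2 := mul_le_mul_of_nonneg_left h2 (Real.exp_pos (s * (μ - t))).le
  rw [← Real.exp_add] at e1 e2
  have hexp : -(t ^ 2 / (6 * c)) = -s * t + 3 / 4 * s ^ 2 * (c * 2) := by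
    rw [hs]; field_simp; ring
  have r1 : -s * (μ + t) + (s * μ + 3 / 4 * s ^ 2 * (c * (1 + 1))) = -(t ^ 2 / (6 * c)) := by
    rw [hexp]; ring
  have r2 : s * (μ - t) + (-s * μ + 3 / 4 * (-s) ^ 2 * (c * (1 + 1))) = -(t ^ 2 / (6 * c)) := by
    rw [hexp]; ring
  rw [r1] at e1
  rw [r2] at e2
  linarith

/-- The expectation as a sum over subsets. -/
theorem seqExp_eq_sum (q : U → ℝ) {l : List U} (hl : l.Nodup) (φ : Finset U → ℝ)
    (S : Finset U) : seqExp q l φ S = ∑ T ∈ l.toFinset.powerset,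
      (∏ x ∈ T, q x) * (∏ x ∈ l.toFinset \ T, (1 - q x)) * φ (S ∪ T) := by
  induction l generalizing S with
  | nil => simp [seqExp]
  | cons x l ih =>
    obtain ⟨hxl, hl⟩ := List.nodup_cons.1 hl
    have hx : x ∉ l.toFinset := by simpa using hxl
    rw [List.toFinset_cons, Finset.sum_powerset_insert hx, seqExp, ih hl, ih hl, add_comm,
      Finset.mul_sum, Finset.mul_sum]
    congr 1
    · refine Finset.sum_congr rfl fun T hT => ?_
      have hxT : x ∉ T := fun h => hx (Finset.mem_powerset.1 hT h)
      rw [Finset.insert_sdiff_of_notMem _ hxT, Finset.prod_insert (by simp [hx])]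
      ring
    · refine Finset.sum_congr rfl fun T hT => ?_
      have hxT : x ∉ T := fun h => hx (Finset.mem_powerset.1 hT h)
      rw [Finset.prod_insert hxT, Finset.insert_sdiff_insert, Finset.sdiff_insert_of_notMem hx,
        Finset.insert_union, Finset.union_insert]
      ring

end RandomSubset

open Classical in
theorem productProb_eq_seqExp {U : Type} [Fintype U] [LinearOrder U] (p : U → unitInterval)
    (E : Finset U → Prop) :
    productProb p E = seqExp (fun x => (p x : ℝ)) (universeList U) (fun S => if E S then 1 else 0) ∅ := by
  have hn : (universeList U).Nodup := Finset.sort_nodup _ _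
  have hu : (universeList U).toFinset = Finset.univ := Finset.sort_toFinset _ _
  rw [seqExp_eq_sum _ hn, hu, Finset.powerset_univ, productProb]
  refine Finset.sum_congr rfl fun S _ => ?_
  rw [Finset.empty_union, productWeight, Finset.compl_eq_univ_sdiff]
  split_ifs <;> simp

/-! ### Reasoning about programs -/

namespace Prog

variable {U A B X : Type} {O : Finset U → ℝ}

theorem andThen_assoc {C : Type} (c : Prog U A) (k : A → Prog U B) (k' : B → Prog U C) :
    (c.andThen k).andThen k' = c.andThen fun a => (k a).andThen k' := by
  induction c with
  | ret a => rfl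
  | work n next ih => simp only [andThen, ih]
  | query S next ih => simp only [andThen, ih]
  | toss q next ih => simp only [andThen, ih]

theorem andThen_ret (c : Prog U A) : c.andThen ret = c := by
  induction c with
  | ret a => rfl
  | work n next ih => simp only [andThen, ih]
  | query S next ih => simp only [andThen, ih]
  | toss q next ih => simp only [andThen, ih]

instance : LawfulMonad (Prog U) :=
  LawfulMonad.mk' (Prog U) andThen_ret (fun _ _ => rfl) andThen_assoc

theorem time_bind_le {c : Prog U A} {k : A → Prog U B} {t : ℕ}
    (h : ∀ a, c.CanReturn O a → (k a).time O ≤ t) : (c >>= k).time O ≤ c.time O + t := by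
  change (c.andThen k).time O ≤ _
  induction c with
  | ret a => simpa [andThen, time] using h a rfl
  | work n next ih =>
    have := ih h
    simp only [andThen, time]; omega
  | query S next ih =>
    have := ih (O S) h
    simp only [andThen, time]; omega
  | toss q next ih =>
    have h1 := ih true fun a ha => h a (Or.inl ha)
    have h2 := ih false fun a ha => h a (Or.inr ha)
    simp only [andThen, time]; omega

theorem canReturn_bind {c : Prog U A} {k : A → Prog U B} {b : B} :
    (c >>= k).CanReturn O b ↔ ∃ a, c.CanReturn O a ∧ (k a).CanReturn O b := by
  change (c.andThen k).CanReturn O b ↔ _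
  induction c with
  | ret a => simp [andThen, CanReturn]
  | work n next ih => exact ih
  | query S next ih => exact ih _
  | toss q next ih => simp only [andThen, CanReturn, ih, or_and_right, exists_or]

/-- Every run takes at most `t` steps and returns a result that satisfies `Q`. -/
def Ensures (O : Finset U → ℝ) (t : ℕ) (Q : A → Prop) (c : Prog U A) : Prop :=
  c.time O ≤ t ∧ ∀ a, c.CanReturn O a → Q a

theorem Ensures.mono {t t' : ℕ} {Q Q' : A → Prop} {c : Prog U A} (h : c.Ensures O t Q)
    (ht : t ≤ t') (hQ : ∀ a, Q a → Q' a) : c.Ensures O t' Q' :=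
  ⟨h.1.trans ht, fun a ha => hQ a (h.2 a ha)⟩

theorem Ensures.pure {t : ℕ} {Q : A → Prop} {a : A} (h : Q a) :
    Ensures (U := U) O t Q (Pure.pure a) :=
  ⟨Nat.zero_le _, by rintro _ rfl; exact h⟩

theorem Ensures.work {n t : ℕ} {Q : A → Prop} {a : A} (h : Q a) (ht : n ≤ t) :
    Ensures (U := U) O t Q (Prog.work n (Pure.pure a)) :=
  ⟨ht, by rintro _ rfl; exact h⟩

theorem ensures_arith (a : A) : Ensures (U := U) O 1 (· = a) (arith a) :=
  Ensures.work rfl le_rfl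

theorem ensures_setOp [Fintype U] (a : A) :
    Ensures (U := U) O (Fintype.card U + 1) (· = a) (setOp a) :=
  Ensures.work rfl le_rfl

theorem ensures_ask (S : Finset U) : Ensures O 1 (· = O S) (ask S) :=
  ⟨le_rfl, by rintro _ rfl; rfl⟩

theorem Ensures.bind {t₁ t₂ t : ℕ} {Q : A → Prop} {Q' : B → Prop} {c : Prog U A}
    {k : A → Prog U B} (hc : c.Ensures O t₁ Q) (hk : ∀ a, Q a → (k a).Ensures O t₂ Q')
    (ht : t₁ + t₂ ≤ t) : (c >>= k).Ensures O t Q' := by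
  refine ⟨?_, fun b hb => ?_⟩
  · exact (time_bind_le fun a ha => (hk a (hc.2 a ha)).1).trans
      ((Nat.add_le_add_right hc.1 _).trans ht)
  · obtain ⟨a, ha, hb⟩ := canReturn_bind.1 hb
    exact (hk a (hc.2 a ha)).2 b hb

/-- The rule for a deterministic first part. -/
theorem Ensures.bind_eq {t₁ t₂ t : ℕ} {a : A} {Q' : B → Prop} {c : Prog U A}
    {k : A → Prog U B} (hc : c.Ensures O t₁ (· = a)) (hk : (k a).Ensures O t₂ Q')
    (ht : t₁ + t₂ ≤ t) : (c >>= k).Ensures O t Q' :=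
  hc.bind (by rintro _ rfl; exact hk) ht

theorem Ensures.foldlM {t : ℕ} {step : B → A → B} {f : B → A → Prog U B} {l : List A} (b : B)
    (h : ∀ x ∈ l, ∀ s, (f s x).Ensures O t (· = step s x)) :
    (l.foldlM f b).Ensures O (l.length * t) (· = l.foldl step b) := by
  induction l generalizing b with
  | nil => exact Ensures.pure rfl
  | cons x l ih =>
    rw [List.foldlM_cons, List.foldl_cons]
    refine (h x List.mem_cons_self b).bind_eq
      (ih _ fun y hy => h y (List.mem_cons_of_mem _ hy)) ?_
    rw [List.length_cons]; ring_nf; rfl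

theorem Ensures.foldlM_time {t : ℕ} {f : B → A → Prog U B} {l : List A} (b : B)
    (h : ∀ x ∈ l, ∀ s, (f s x).Ensures O t fun _ => True) :
    (l.foldlM f b).Ensures O (l.length * t) fun _ => True := by
  induction l generalizing b with
  | nil => exact Ensures.pure trivial
  | cons x l ih =>
    rw [List.foldlM_cons]
    refine (h x List.mem_cons_self b).bind
      (fun _ _ => ih _ fun y hy => h y (List.mem_cons_of_mem _ hy)) ?_
    rw [List.length_cons]; ring_nf; rfl

theorem Ensures.mapM {t : ℕ} {R : A → B → Prop} {f : A → Prog U B} {l : List A}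
    (h : ∀ x ∈ l, (f x).Ensures O t (R x)) :
    (l.mapM f).Ensures O (l.length * t) (List.Forall₂ R l) := by
  induction l with
  | nil => exact Ensures.pure List.Forall₂.nil
  | cons x l ih =>
    rw [List.mapM_cons]
    refine (h x List.mem_cons_self).bind (fun y hy => (ih fun y hy =>
      h y (List.mem_cons_of_mem _ hy)).bind (fun ys hys =>
        Ensures.pure (t := 0) (List.Forall₂.cons hy hys)) le_rfl) ?_
    rw [List.length_cons]; ring_nf; rfl

theorem Ensures.mapM_eq {t : ℕ} {g : A → B} {f : A → Prog U B} {l : List A}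
    (h : ∀ x ∈ l, (f x).Ensures O t (· = g x)) :
    (l.mapM f).Ensures O (l.length * t) (· = l.map g) := by
  refine (Ensures.mapM h).mono le_rfl fun ys hys => ?_
  have : List.Forall₂ (fun x y => y = g x) l ys → ys = l.map g := by
    clear hys h
    intro hys
    induction hys with
    | nil => rfl
    | cons h _ ih => rw [h, ih, List.map_cons]
  exact this hys

/-! ### Expectations -/

/-- The expectation of `g` at the result of a run with the oracle `O`. -/
noncomputable def expect (O : Finset U → ℝ) (g : A → ℝ) : Prog U A → ℝ
  | ret a => g a
  | work _ next => expect O g next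
  | query S next => expect O g (next (O S))
  | toss q next => (q : ℝ) * expect O g (next true) + (1 - (q : ℝ)) * expect O g (next false)

open Classical in
theorem prob_eq_expect (E : A → Prop) (c : Prog U A) :
    c.prob O E = c.expect O fun a => if E a then 1 else 0 := by
  induction c with
  | ret a => rfl
  | work n next ih => exact ih
  | query S next ih => exact ih _
  | toss q next ih => simp only [prob, expect, ih]

theorem expect_bind (g : B → ℝ) (c : Prog U A) (k : A → Prog U B) :
    (c >>= k).expect O g = c.expect O fun a => (k a).expect O g := by
  change (c.andThen k).expect O g = _
  induction c with
  | ret a => rfl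
  | work n next ih => exact ih
  | query S next ih => exact ih _
  | toss q next ih => simp only [andThen, expect, ih]

theorem expect_const (r : ℝ) (c : Prog U A) : c.expect O (fun _ => r) = r := by
  induction c with
  | ret a => rfl
  | work n next ih => exact ih
  | query S next ih => exact ih _
  | toss q next ih => simp only [expect, ih]; ring

theorem expect_add (g g' : A → ℝ) (c : Prog U A) :
    c.expect O (fun a => g a + g' a) = c.expect O g + c.expect O g' := by
  induction c with
  | ret a => rfl
  | work n next ih => exact ih
  | query S next ih => exact ih _
  | toss q next ih => simp only [expect, ih]; ring

theorem expect_mul_left (r : ℝ) (g : A → ℝ) (c : Prog U A) :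
    c.expect O (fun a => r * g a) = r * c.expect O g := by
  induction c with
  | ret a => rfl
  | work n next ih => exact ih
  | query S next ih => exact ih _
  | toss q next ih => simp only [expect, ih]; ring

theorem expect_mono {g g' : A → ℝ} {c : Prog U A} (h : ∀ a, c.CanReturn O a → g a ≤ g' a) :
    c.expect O g ≤ c.expect O g' := by
  induction c with
  | ret a => exact h a rfl
  | work n next ih => exact ih h
  | query S next ih => exact ih _ h
  | toss q next ih =>
    exact add_le_add
      (mul_le_mul_of_nonneg_left (ih true fun a ha => h a (Or.inl ha)) q.2.1)
      (mul_le_mul_of_nonneg_left (ih false fun a ha => h a (Or.inr ha)) (sub_nonneg.2 q.2.2))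

theorem expect_of_ensures_eq {t : ℕ} {a : A} {c : Prog U A} (h : c.Ensures O t (· = a))
    (g : A → ℝ) : c.expect O g = g a := by
  rw [← expect_const (O := O) (g a) c]
  apply le_antisymm <;> refine expect_mono fun b hb => ?_
  · rw [h.2 b hb]
  · rw [h.2 b hb]

open Classical in
theorem prob_nonneg (E : A → Prop) (c : Prog U A) : 0 ≤ c.prob O E := by
  have h := expect_mono (O := O) (c := c) (g := fun _ => 0) (g' := fun a => if E a then 1 else 0)
    fun a _ => by split_ifs <;> norm_num
  rwa [expect_const, ← prob_eq_expect] at h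

theorem prob_mono {E E' : A → Prop} {c : Prog U A} (h : ∀ a, E a → E' a) :
    c.prob O E ≤ c.prob O E' := by
  rw [prob_eq_expect, prob_eq_expect]
  refine expect_mono fun a _ => ?_
  split_ifs with h1 h2 h2
  · exact le_rfl
  · exact absurd (h a h1) h2
  · exact zero_le_one
  · exact le_rfl

theorem prob_bind_of_ensures {t : ℕ} {a : A} {c : Prog U A} {k : A → Prog U B} {E : B → Prop}
    (hc : c.Ensures O t (· = a)) : (c >>= k).prob O E = (k a).prob O E := by
  rw [prob_eq_expect, prob_eq_expect, expect_bind, expect_of_ensures_eq hc]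

theorem prob_pure {a : A} {E : A → Prop} (h : E a) :
    (Pure.pure a : Prog U A).prob O E = 1 := if_pos h

theorem prob_bind_ge {a b : ℝ} (hb : 0 ≤ b) {c : Prog U A} {k : A → Prog U B} {Q : A → Prop}
    {E : B → Prop} (hc : 1 - a ≤ c.prob O Q) (hk : ∀ x, Q x → 1 - b ≤ (k x).prob O E) :
    1 - (a + b) ≤ (c >>= k).prob O E := by
  classical
  rw [prob_eq_expect, expect_bind]
  have : c.expect O (fun x => (if Q x then (1 : ℝ) else 0) + -b) ≤
      c.expect O (fun x => (k x).expect O fun y => if E y then (1 : ℝ) else 0) := by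
    refine expect_mono fun x _ => ?_
    rw [← prob_eq_expect]
    split_ifs with h
    · linarith [hk x h]
    · linarith [prob_nonneg (O := O) E (k x)]
  rw [expect_add, expect_const, ← prob_eq_expect] at this
  linarith

theorem prob_mapM_ge {ε : A → ℝ} (hε : ∀ x, 0 ≤ ε x) {R : A → B → Prop} {f : A → Prog U B}
    {l : List A} (h : ∀ x ∈ l, 1 - ε x ≤ (f x).prob O (R x)) :
    1 - (l.map ε).sum ≤ (l.mapM f).prob O (List.Forall₂ R l) := by
  induction l with
  | nil => rw [List.mapM_nil, prob_pure List.Forall₂.nil]; simp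
  | cons x l ih =>
    rw [List.mapM_cons, List.map_cons, List.sum_cons]
    have hs : 0 ≤ (l.map ε).sum := List.sum_nonneg (by simpa using fun a _ => hε a)
    refine prob_bind_ge hs (h x List.mem_cons_self) fun y hy => ?_
    rw [← add_zero (l.map ε).sum]
    refine prob_bind_ge le_rfl (ih fun z hz => h z (List.mem_cons_of_mem _ hz)) fun ys hys => ?_
    rw [prob_pure (List.Forall₂.cons hy hys)]; simp

end Prog

/-! ### The decomposition as a function -/

section DecompositionSpec

variable {U : Type} [Fintype U] [LinearOrder U]

/-- The marginal value of `x` at `B`. -/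
def marg (g : Finset U → ℝ) (x : U) (B : Finset U) : ℝ := g (insert x B) - g B

/-- One step of the enumeration. -/
noncomputable def growFamily (g : Finset U → ℝ) (θ : ℝ) (I : List (Finset U)) (x : U) :
    List (Finset U) :=
  I ++ ((I.filter fun B => θ < marg g x B).map (insert x)).reverse

/-- The enumeration of a family of sets, from the family `I`. -/
noncomputable def enumSets (g : Finset U → ℝ) (θ : ℝ) (xs : List U) (I : List (Finset U)) :
    List (Finset U) :=
  xs.foldl (growFamily g θ) I

/-- The elements of marginal value at most `θ` at `B`. -/
noncomputable def lowSet (g : Finset U → ℝ) (θ : ℝ) (xs : List U) (B : Finset U) : Finset U :=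
  (xs.filter fun x => marg g x B ≤ θ).toFinset

/-- One step of a scan of `S`, with the set of accepted and the set of rejected elements. -/
noncomputable def scanStep (g : Finset U → ℝ) (θ : ℝ) (S : Finset U)
    (s : Finset U × Finset U) (x : U) : Finset U × Finset U :=
  if θ < marg g x s.1 then
    if x ∈ S then (insert x s.1, s.2) else (s.1, insert x s.2)
  else s

/-- The scan of `S` along the list `xs`. -/
noncomputable def scan (g : Finset U → ℝ) (θ : ℝ) (S : Finset U) (xs : List U)
    (s : Finset U × Finset U) : Finset U × Finset U :=
  xs.foldl (scanStep g θ S) s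

/-- The piece with base `B`. -/
noncomputable def pieceOf (g : Finset U → ℝ) (γ : ℝ) (xs : List U) (B : Finset U) : Piece U where
  base := B
  dom := lowSet g (2 * γ / 3) xs B
  low := lowSet g (γ / 3) xs B
  rej := (scan g (γ / 3) B xs (∅, ∅)).2

/-! #### Properties of scans -/

section Scan

variable {g : Finset U → ℝ} {θ : ℝ}

theorem scan_nil (S : Finset U) (s : Finset U × Finset U) : scan g θ S [] s = s := rfl

theorem scan_cons (S : Finset U) (x : U) (xs : List U) (s : Finset U × Finset U) :
    scan g θ S (x :: xs) s = scan g θ S xs (scanStep g θ S s x) := rfl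

theorem scan_mono (S : Finset U) (xs : List U) (s : Finset U × Finset U) :
    s.1 ⊆ (scan g θ S xs s).1 ∧ s.2 ⊆ (scan g θ S xs s).2 := by
  induction xs generalizing s with
  | nil => exact ⟨subset_rfl, subset_rfl⟩
  | cons x xs ih =>
    rw [scan_cons]
    refine ⟨subset_trans ?_ (ih _).1, subset_trans ?_ (ih _).2⟩ <;>
    · unfold scanStep; split_ifs <;> simp

theorem scan_fst_subset (S : Finset U) (xs : List U) (s : Finset U × Finset U) :
    (scan g θ S xs s).1 ⊆ s.1 ∪ (S ∩ xs.toFinset) := by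
  induction xs generalizing s with
  | nil => simp [scan_nil]
  | cons x xs ih =>
    rw [scan_cons]
    refine (ih _).trans ?_
    unfold scanStep
    split_ifs with h1 h2 <;> intro y hy <;> simp at hy ⊢ <;> grind

theorem scan_snd_subset (S : Finset U) (xs : List U) (s : Finset U × Finset U) :
    (scan g θ S xs s).2 ⊆ s.2 ∪ (xs.toFinset \ S) := by
  induction xs generalizing s with
  | nil => simp [scan_nil]
  | cons x xs ih =>
    rw [scan_cons]
    refine (ih _).trans ?_
    unfold scanStep
    split_ifs with h1 h2 <;> intro y hy <;> simp at hy ⊢ <;> grind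

/-- A scan depends only on the elements that it accepts or rejects. -/
theorem scan_congr {S S' : Finset U} {xs : List U} {s : Finset U × Finset U}
    (h : ∀ x ∈ (scan g θ S xs s).1 ∪ (scan g θ S xs s).2, (x ∈ S ↔ x ∈ S')) :
    scan g θ S' xs s = scan g θ S xs s := by
  induction xs generalizing s with
  | nil => rfl
  | cons x xs ih =>
    rw [scan_cons] at h
    have hstep : scanStep g θ S' s x = scanStep g θ S s x := by
      by_cases hx : θ < marg g x s.1
      · have : x ∈ (scanStep g θ S s x).1 ∪ (scanStep g θ S s x).2 := by
          unfold scanStep; split_ifs <;> simp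
        have hm := scan_mono (g := g) (θ := θ) S xs (scanStep g θ S s x)
        have := h x (Finset.union_subset_union hm.1 hm.2 this)
        simp only [scanStep, this]
      · simp only [scanStep, hx, if_false]
    rw [scan_cons, scan_cons, hstep]
    exact ih h

theorem scan_scan_fst (S : Finset U) (xs : List U) :
    scan g θ (scan g θ S xs (∅, ∅)).1 xs (∅, ∅) = scan g θ S xs (∅, ∅) := by
  refine scan_congr fun x hx => ?_
  have h1 := scan_fst_subset (g := g) (θ := θ) S xs (∅, ∅)
  have h2 := scan_snd_subset (g := g) (θ := θ) S xs (∅, ∅)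
  constructor
  · intro hxS
    rcases Finset.mem_union.1 hx with h | h
    · exact h
    · have := h2 h; simp at this; exact absurd hxS this.2
  · intro h
    have := h1 h; simp at this; exact this.1

theorem exists_marg_le_of_notMem_scan {S : Finset U} {xs : List U} {s : Finset U × Finset U}
    {x : U} (hx : x ∈ xs) (h1 : x ∉ (scan g θ S xs s).1) (h2 : x ∉ (scan g θ S xs s).2) :
    ∃ B ⊆ (scan g θ S xs s).1, marg g x B ≤ θ := by
  induction xs generalizing s with
  | nil => simp at hx
  | cons y xs ih =>
    rw [scan_cons] at h1 h2 ⊢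
    rcases List.mem_cons.1 hx with rfl | hx
    · have hm := scan_mono (g := g) (θ := θ) S xs (scanStep g θ S s x)
      have hle : marg g x s.1 ≤ θ := by
        by_contra hlt
        rw [not_le] at hlt
        have : x ∈ (scanStep g θ S s x).1 ∪ (scanStep g θ S s x).2 := by
          unfold scanStep; split_ifs <;> simp
        rcases Finset.mem_union.1 this with h | h
        · exact h1 (hm.1 h)
        · exact h2 (hm.2 h)
      refine ⟨s.1, subset_trans ?_ hm.1, hle⟩
      rw [scanStep, if_neg (not_lt.2 hle)]
    · exact ih hx h1 h2

theorem subset_enumSets (xs : List U) {I : List (Finset U)} {B : Finset U} (h : B ∈ I) :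
    B ∈ enumSets g θ xs I := by
  induction xs generalizing I with
  | nil => exact h
  | cons x xs ih => exact ih (List.mem_append_left _ h)

theorem scan_mem_enumSets (S : Finset U) (xs : List U) {I : List (Finset U)}
    {s : Finset U × Finset U} (h : s.1 ∈ I) :
    (scan g θ S xs s).1 ∈ enumSets g θ xs I := by
  induction xs generalizing I s with
  | nil => exact h
  | cons x xs ih =>
    rw [scan_cons]
    refine ih ?_
    unfold scanStep growFamily
    split_ifs with h1 h2
    · refine List.mem_append_right _ ?_
      simp only [List.mem_reverse, List.mem_map, List.mem_filter, decide_eq_true_eq]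
      exact ⟨s.1, ⟨h, h1⟩, rfl⟩
    · exact List.mem_append_left _ h
    · exact List.mem_append_left _ h

end Scan

/-! #### The size of the enumerated family -/

theorem length_growFamily_ge (g : Finset U → ℝ) (θ : ℝ) (xs : List U) (I : List (Finset U)) :
    I.length ≤ (enumSets g θ xs I).length := by
  induction xs generalizing I with
  | nil => exact le_rfl
  | cons x xs ih =>
    refine le_trans ?_ (ih _)
    simp [growFamily]

theorem enumSets_invariant {g : Finset U → ℝ} {θ : ℝ} {xs : List U} (hxs : xs.Nodup)
    {I : List (Finset U)} (hI : I.Nodup) (hdisj : ∀ B ∈ I, ∀ x ∈ xs, x ∉ B) {r : ℝ}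
    (hcard : ∀ B ∈ I, B.card * θ ≤ g B - r) :
    (enumSets g θ xs I).Nodup ∧ ∀ B ∈ enumSets g θ xs I, B.card * θ ≤ g B - r := by
  induction xs generalizing I with
  | nil => exact ⟨hI, hcard⟩
  | cons x xs ih =>
    obtain ⟨hx, hxs⟩ := List.nodup_cons.1 hxs
    have hmem : ∀ B, B ∈ growFamily g θ I x ↔
        B ∈ I ∨ ∃ B' ∈ I, θ < marg g x B' ∧ insert x B' = B := by
      intro B; simp [growFamily, and_assoc]
    refine ih hxs ?_ ?_ ?_
    · refine List.nodup_append.2 ⟨hI, ?_, ?_⟩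
      · rw [List.nodup_reverse]
        refine List.Nodup.map_on ?_ (hI.filter _)
        intro B hB B' hB' h
        have h1 := hdisj B (List.mem_of_mem_filter hB) x List.mem_cons_self
        have h2 := hdisj B' (List.mem_of_mem_filter hB') x List.mem_cons_self
        rw [← Finset.erase_insert h1, h, Finset.erase_insert h2]
      · rintro B hB _ hB' rfl
        simp only [List.mem_reverse, List.mem_map] at hB'
        obtain ⟨B', _, rfl⟩ := hB'
        exact hdisj _ hB x List.mem_cons_self (Finset.mem_insert_self _ _)
    · intro B hB y hy
      rcases (hmem B).1 hB with h | ⟨B', h, _, rfl⟩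
      · exact hdisj B h y (List.mem_cons_of_mem _ hy)
      · simp only [Finset.mem_insert, not_or]
        exact ⟨fun e => hx (e ▸ hy), hdisj B' h y (List.mem_cons_of_mem _ hy)⟩
    · intro B hB
      rcases (hmem B).1 hB with h | ⟨B', h, hm, rfl⟩
      · exact hcard B h
      · rw [Finset.card_insert_of_notMem (hdisj B' h x List.mem_cons_self)]
        have := hcard B' h
        unfold marg at hm
        push_cast
        linarith

theorem card_filter_card_le (U : Type) [Fintype U] [DecidableEq U] (k : ℕ) :
    (Finset.univ.filter fun B : Finset U => B.card ≤ k).card ≤ (Fintype.card U + 1) ^ k := by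
  have hsub : (Finset.univ.filter fun B : Finset U => B.card ≤ k) ⊆
      (Finset.univ : Finset (Fin k → Option U)).image
        (fun v => Finset.univ.filter fun x => ∃ i, v i = some x) := by
    intro B hB
    have hB : B.card ≤ k := (Finset.mem_filter.1 hB).2
    refine Finset.mem_image.2 ⟨fun i => B.toList[(i : ℕ)]?, Finset.mem_univ _, ?_⟩
    ext x
    simp only [Finset.mem_filter, Finset.mem_univ, true_and]
    constructor
    · rintro ⟨i, hi⟩
      exact Finset.mem_toList.1 (List.mem_of_getElem? hi)
    · intro hx
      obtain ⟨i, hi, hx⟩ := List.getElem_of_mem (Finset.mem_toList.2 hx)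
      refine ⟨⟨i, (by simpa using hi : i < B.card).trans_le hB⟩, ?_⟩
      rw [List.getElem?_eq_getElem hi, hx]
  refine (Finset.card_le_card hsub).trans (Finset.card_image_le.trans ?_)
  simp [Fintype.card_option]

theorem length_enumSets_le {g : Finset U → ℝ} {θ : ℝ} {xs : List U} (hxs : xs.Nodup) {k : ℕ}
    (h : ∀ B : Finset U, B.card * θ ≤ g B - g ∅ → B.card ≤ k) :
    (enumSets g θ xs [∅]).length ≤ (Fintype.card U + 1) ^ k := by
  obtain ⟨h1, h2⟩ := enumSets_invariant (g := g) (θ := θ) (I := [∅]) (r := g ∅) hxs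
    (by simp) (by simp) (by simp)
  rw [← List.toFinset_card_of_nodup h1]
  refine (Finset.card_le_card fun B hB => ?_).trans (card_filter_card_le U k)
  simp only [Finset.mem_filter, Finset.mem_univ, true_and]
  exact h B (h2 B (List.mem_toFinset.1 hB))

/-! #### The programs compute these functions -/

section Programs

variable {O g : Finset U → ℝ} {probe : Finset U → Prog U ℝ} {c : ℕ}

open Prog

theorem ensures_marginal (hp : ∀ S, (probe S).Ensures O c (· = g S)) (x : U) (B : Finset U) :
    (marginal probe x B).Ensures O (2 * c + Fintype.card U + 2) (· = marg g x B) := by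
  unfold marginal
  refine (ensures_setOp _).bind_eq ((hp _).bind_eq ((hp _).bind_eq (ensures_arith _) le_rfl)
    le_rfl) (by omega)

theorem ensures_enumerate (hp : ∀ S, (probe S).Ensures O c (· = g S)) (γ : ℝ) (xs : List U)
    {M : ℕ} (hM : (enumSets g (γ / 3) xs [∅]).length ≤ M) :
    (enumerate probe γ xs).Ensures O
      (xs.length * (M * (2 * c + 2 * Fintype.card U + 6) + 1))
      (· = enumSets g (γ / 3) xs [∅]) := by
  unfold enumerate
  generalize ([∅] : List (Finset U)) = I at hM ⊢
  induction xs generalizing I with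
  | nil => exact Ensures.pure rfl
  | cons x xs ih =>
    rw [List.foldlM_cons]
    have hle := (length_growFamily_ge g (γ / 3) xs (growFamily g (γ / 3) I x)).trans hM
    have hlen : (growFamily g (γ / 3) I x).length = I.length +
        (((I.filter fun B => γ / 3 < marg g x B).map (insert x)).reverse).length := by
      rw [growFamily, List.length_append]
    have hIM : I.length ≤ M := by omega
    refine Ensures.bind_eq (t₁ := M * (2 * c + 2 * Fintype.card U + 6) + 1)
      (a := growFamily g (γ / 3) I x) ?_ (ih _ hM) ?_
    · refine Ensures.bind_eq
        (a := ((I.filter fun B => γ / 3 < marg g x B).map (insert x)).reverse)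
        (t₁ := I.length * (2 * c + 2 * Fintype.card U + 5))
        (t₂ := M + 1) ?_ (Ensures.work rfl (by omega)) ?_
      · have hfold : ∀ J : List (Finset U), ((I.filter fun B => γ / 3 < marg g x B).map
            (insert x)).reverse ++ J = I.foldl (fun I' B =>
              if γ / 3 < marg g x B then insert x B :: I' else I') J := by
          intro J
          clear hM hle hlen hIM
          induction I generalizing J with
          | nil => rfl
          | cons B I ih =>
            rw [List.foldl_cons, ← ih]
            by_cases h : γ / 3 < marg g x B <;> simp [h]
        rw [← List.append_nil (List.reverse _), hfold]
        refine Ensures.foldlM [] fun B _ I' => ?_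
        refine (ensures_marginal hp x B).bind_eq ((ensures_arith _).bind_eq
          (t₂ := Fintype.card U + 2) ?_ le_rfl) (by omega)
        by_cases h : γ / 3 < marg g x B
        · simp only [h, decide_true, if_true]
          exact (ensures_setOp _).bind_eq (ensures_arith _) (by omega)
        · simp only [h, decide_false, if_false, Bool.false_eq_true]
          exact Ensures.pure rfl
      · have := Nat.mul_le_mul_right (2 * c + 2 * Fintype.card U + 5) hIM
        linarith
    · rw [List.length_cons]; exact le_of_eq (by ring)

theorem ensures_smallMarginals (hp : ∀ S, (probe S).Ensures O c (· = g S)) (θ : ℝ)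
    (xs : List U) (B : Finset U) :
    (smallMarginals probe θ xs B).Ensures O
      (xs.length * (2 * c + 2 * Fintype.card U + 6)) (· = lowSet g θ xs B) := by
  unfold smallMarginals
  have hfold : lowSet g θ xs B = xs.foldl (fun V x =>
      if marg g x B ≤ θ then insert x V else V) ∅ := by
    have : ∀ V : Finset U, xs.foldl (fun V x =>
        if marg g x B ≤ θ then insert x V else V) V = V ∪ lowSet g θ xs B := by
      intro V
      induction xs generalizing V with
      | nil => simp [lowSet]
      | cons x xs ih =>
        rw [List.foldl_cons, ih]
        by_cases h : marg g x B ≤ θ <;> simp [h, lowSet]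
    rw [this, Finset.empty_union]
  rw [hfold]
  refine Ensures.foldlM ∅ fun x _ V => ?_
  refine (ensures_marginal hp x B).bind_eq ((ensures_arith _).bind_eq
    (t₂ := Fintype.card U + 1) ?_ le_rfl) (by omega)
  by_cases h : marg g x B ≤ θ
  · simp only [h, decide_true, if_true]
    exact ensures_setOp _
  · simp only [h, decide_false, if_false, Bool.false_eq_true]
    exact Ensures.pure rfl

theorem ensures_rejected (hp : ∀ S, (probe S).Ensures O c (· = g S)) (γ : ℝ)
    (xs : List U) (B : Finset U) :
    (rejected probe γ xs B).Ensures O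
      (xs.length * (2 * c + 2 * Fintype.card U + 6)) (· = (scan g (γ / 3) B xs (∅, ∅)).2) := by
  unfold rejected
  refine Ensures.bind_eq (t₁ := xs.length * (2 * c + 2 * Fintype.card U + 6)) (t₂ := 0)
    (a := scan g (γ / 3) B xs (∅, ∅)) ?_ (Ensures.pure rfl) le_rfl
  refine Ensures.foldlM (step := scanStep g (γ / 3) B) _ fun x _ s => ?_
  refine (ensures_marginal hp x s.1).bind_eq ((ensures_arith _).bind_eq
    (t₂ := Fintype.card U + 2) ?_ le_rfl) (by omega)
  by_cases h : γ / 3 < marg g x s.1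
  · simp only [h, decide_true, if_true, scanStep]
    refine (ensures_arith _).bind_eq (t₂ := Fintype.card U + 1) ?_ (by omega)
    by_cases h : x ∈ B
    · simp only [h, decide_true, if_true]
      exact (ensures_setOp _).bind_eq (Ensures.pure (t := 0) rfl) (by omega)
    · simp only [h, decide_false, if_false, Bool.false_eq_true]
      exact (ensures_setOp _).bind_eq (Ensures.pure (t := 0) rfl) (by omega)
  · simp only [h, decide_false, if_false, Bool.false_eq_true, scanStep]
    exact Ensures.pure rfl

theorem ensures_decompose (hp : ∀ S, (probe S).Ensures O c (· = g S)) (γ : ℝ) (xs : List U)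
    (hxs : xs.length ≤ Fintype.card U)
    {M : ℕ} (hM : (enumSets g (γ / 3) xs [∅]).length ≤ M) :
    (decompose probe γ xs).Ensures O
      ((Fintype.card U + 1) * M * (4 * (2 * c + 2 * Fintype.card U + 6) + 1) + Fintype.card U)
      (· = (enumSets g (γ / 3) xs [∅]).map (pieceOf g γ xs)) := by
  unfold decompose
  set q := 2 * c + 2 * Fintype.card U + 6 with hq
  refine (ensures_enumerate hp γ xs hM).bind_eq (Ensures.mapM_eq
    (t := Fintype.card U * q + (Fintype.card U * q + (Fintype.card U * q + 1)))
    fun B _ => ?_) ?_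
  · have hmul := Nat.mul_le_mul_right q hxs
    refine ((ensures_smallMarginals hp _ xs B).mono hmul fun _ h => h).bind_eq
      (((ensures_smallMarginals hp _ xs B).mono hmul fun _ h => h).bind_eq
        (((ensures_rejected hp _ xs B).mono hmul fun _ h => h).bind_eq
          (ensures_arith _) le_rfl) le_rfl) le_rfl
  · have h1 := Nat.mul_le_mul_right (M * q + 1) hxs
    have h2 := Nat.mul_le_mul_right
      (Fintype.card U * q + (Fintype.card U * q + (Fintype.card U * q + 1))) hM
    refine (Nat.add_le_add h1 h2).trans ?_
    nlinarith [Nat.zero_le (M * q), Nat.zero_le (M * Fintype.card U)]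

end Programs

/-! #### The two stages -/

/-- The ground set of the second stage for the piece `P`. -/
def groundList (P : Piece U) : List U := (universeList U).filter (fun x => x ∈ P.dom)

/-- The function that the second stage decomposes for the piece `P`. -/
def complementFn (O : Finset U → ℝ) (P : Piece U) (S : Finset U) : ℝ := O ((P.dom \ S) ∪ P.base)

/-- The pieces of the first stage. -/
noncomputable def stageOne (O : Finset U → ℝ) (γ : ℝ) : List (Piece U) :=
  (enumSets O (γ / 3) (universeList U) [∅]).map (pieceOf O γ (universeList U))

/-- The pieces of the second stage. -/
noncomputable def stageTwo (O : Finset U → ℝ) (γ : ℝ) (P : Piece U) : List (Piece U) :=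
  (enumSets (complementFn O P) (γ / 3) (groundList P) [∅]).map
    (pieceOf (complementFn O P) γ (groundList P))

theorem nodup_universeList : (universeList U).Nodup := Finset.sort_nodup _ _

theorem mem_universeList (x : U) : x ∈ universeList U := by simp [universeList]

theorem length_universeList : (universeList U).length = Fintype.card U := by
  simp [universeList]

theorem nodup_groundList (P : Piece U) : (groundList P).Nodup := nodup_universeList.filter _

theorem mem_groundList {P : Piece U} {x : U} : x ∈ groundList P ↔ x ∈ P.dom := by
  simp [groundList, mem_universeList]

theorem length_groundList_le (P : Piece U) : (groundList P).length ≤ Fintype.card U :=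
  (List.length_filter_le _ _).trans length_universeList.le

theorem ensures_decomposeTwice {O : Finset U → ℝ} {γ : ℝ} {M : ℕ}
    (h1 : (stageOne O γ).length ≤ M) (h2 : ∀ P, (stageTwo O γ P).length ≤ M) :
    (decomposeTwice U γ).Ensures O
      ((M + 1) * ((Fintype.card U + 1) * M * (16 * Fintype.card U + 41) +
        2 * Fintype.card U + 2))
      (· = (stageOne O γ).map fun P => (P, stageTwo O γ P)) := by
  unfold decomposeTwice
  refine (ensures_decompose (M := M) Prog.ensures_ask γ (universeList U)
    length_universeList.le (by simpa [stageOne] using h1)).bind_eq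
    (t₂ := M * ((Fintype.card U + 1) * M * (16 * Fintype.card U + 41) +
        2 * Fintype.card U + 2)) ?_ ?_
  · refine (Prog.Ensures.mapM_eq (t := (Fintype.card U + 1) * M * (16 * Fintype.card U + 41) +
        2 * Fintype.card U + 2) fun P _ => ?_).mono (Nat.mul_le_mul_right _ h1) fun _ h => h
    refine Prog.Ensures.bind_eq (a := stageTwo O γ P) (t₂ := 1)
      (t₁ := (Fintype.card U + 1) * M * (16 * Fintype.card U + 41) + 2 * Fintype.card U + 1)
      ?_ (Prog.ensures_arith _) (by omega)
    unfold decomposeComplement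
    refine Prog.Ensures.bind_eq (a := groundList P) (t₁ := Fintype.card U + 1)
      (Prog.Ensures.work rfl le_rfl) (ensures_decompose (M := M) (c := Fintype.card U + 2)
        (g := complementFn O P) (fun S => ?_) γ _ (length_groundList_le P)
        (by simpa [stageTwo] using h2 P)) ?_
    · exact (Prog.ensures_setOp _).bind_eq (Prog.ensures_ask _) (by omega)
    · nlinarith
  · nlinarith [Nat.zero_le (M * Fintype.card U), Nat.zero_le (M * Fintype.card U^2)]

/-! #### Evaluation -/

theorem Timed.val_bind {A B : Type} (t : Timed A) (k : A → Timed B) :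
    (t >>= k).val = (k t.val).val := rfl

theorem Timed.cost_bind {A B : Type} (t : Timed A) (k : A → Timed B) :
    (t >>= k).cost = t.cost + (k t.val).cost := rfl

theorem Timed.foldlM_val {A B : Type} (f : B → A → Timed B) (l : List A) (b : B) :
    (l.foldlM f b).val = l.foldl (fun b a => (f b a).val) b := by
  induction l generalizing b with
  | nil => rfl
  | cons a l ih => rw [List.foldlM_cons, Timed.val_bind, ih, List.foldl_cons]

theorem Timed.foldlM_cost_le {A B : Type} {f : B → A → Timed B} {t : ℕ}
    (h : ∀ b a, (f b a).cost ≤ t) (l : List A) (b : B) :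
    (l.foldlM f b).cost ≤ l.length * t := by
  induction l generalizing b with
  | nil => exact Nat.zero_le _
  | cons a l ih =>
    rw [List.foldlM_cons, List.length_cons, Nat.succ_mul, add_comm]
    exact Nat.add_le_add (h b a) (ih _)

theorem locate_cost_le {A : Type} (table : List (Piece U × A)) (xs : List U) (S : Finset U) :
    (locate table xs S).cost ≤
      xs.length * ((table.length + 1) * (Fintype.card U + 1) + (Fintype.card U + 3)) := by
  refine Timed.foldlM_cost_le (fun B x => ?_) xs ∅
  refine Nat.add_le_add_left (m := Fintype.card U + 3) ?_ _
  dsimp only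
  split
  · exact Nat.zero_le _
  · split_ifs
    · exact le_rfl
    · exact Nat.le_add_left 2 (Fintype.card U + 1)

theorem lookup_val {A : Type} {table : List (Piece U × A)} {B : Finset U}
    (h : ∃ e ∈ table, e.1.base = B) :
    ∃ e ∈ table, e.1.base = B ∧ (lookup table B).val = some e := by
  have : (table.find? fun e => e.1.base = B).isSome := by
    rw [List.find?_isSome]; simpa using h
  obtain ⟨e, he⟩ := Option.isSome_iff_exists.1 this
  exact ⟨e, List.mem_of_find?_eq_some he, by simpa using List.find?_some he, he⟩

/-- The search in a table of pieces follows the scan. -/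
theorem locate_val {A : Type} {g : Finset U → ℝ} {γ : ℝ} {table : List (Piece U × A)}
    {xs : List U} (hpiece : ∀ e ∈ table, e.1 = pieceOf g γ xs e.1.base)
    (hall : ∀ B ∈ enumSets g (γ / 3) xs [∅], ∃ e ∈ table, e.1.base = B) (S : Finset U) :
    (locate table xs S).val = (scan g (γ / 3) S xs (∅, ∅)).1 := by
  have : ∀ F : Finset U → U → Finset U, (∀ y ∈ xs, ∀ B, (∃ e ∈ table, e.1.base = B) →
      F B y = if y ∈ S ∧ γ / 3 < marg g y B then insert y B else B) →
      xs.foldl F ∅ = (scan g (γ / 3) S xs (∅, ∅)).1 := by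
    intro F hF
    have : ∀ (ys : List U) (I : List (Finset U)) (s : Finset U × Finset U), ys ⊆ xs → s.1 ∈ I →
        (∀ B ∈ enumSets g (γ / 3) ys I, ∃ e ∈ table, e.1.base = B) →
        ys.foldl F s.1 = (scan g (γ / 3) S ys s).1 := by
      intro ys
      induction ys with
      | nil => intros; rfl
      | cons y ys ih =>
        intro I s hsub hs hI
        have hstep : (scanStep g (γ / 3) S s y).1 ∈ growFamily g (γ / 3) I y :=
          scan_mem_enumSets (g := g) (θ := γ / 3) S [y] hs
        have hFs : F s.1 y = (scanStep g (γ / 3) S s y).1 := by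
          rw [hF y (hsub List.mem_cons_self) _ (hI s.1 (subset_enumSets _ hs)), scanStep]
          by_cases h1 : γ / 3 < marg g y s.1 <;> by_cases h2 : y ∈ S <;> simp [h1, h2]
        rw [List.foldl_cons, scan_cons, hFs]
        exact ih _ _ (fun z hz => hsub (List.mem_cons_of_mem _ hz)) hstep hI
    exact this xs [∅] (∅, ∅) (List.Subset.refl _) (by simp) hall
  rw [locate, Timed.foldlM_val]
  refine this _ fun y hy B hB => ?_
  obtain ⟨⟨P, a⟩, he, hbase, hval⟩ := lookup_val hB
  have hP : P = pieceOf g γ xs B := by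
    have := hpiece _ he
    rw [hbase] at this
    exact this
  have hlow : y ∉ P.low ↔ γ / 3 < marg g y B := by
    rw [hP]; simp [pieceOf, lowSet, hy]
  rw [Timed.val_bind, hval]
  dsimp only
  simp only [← hlow]
  split_ifs <;> rfl

end DecompositionSpec

/-! ### Conditioning on the leaf of a decision tree -/

theorem seqExp_eq_zero {U : Type} [DecidableEq U] {q : U → ℝ} (hq : ∀ x, 0 ≤ q x ∧ q x ≤ 1)
    {l : List U} {φ : Finset U → ℝ} {S : Finset U}
    (h : ∀ T, S ⊆ T → T ⊆ S ∪ l.toFinset → φ T = 0) : seqExp q l φ S = 0 := by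
  rw [seqExp_congr hq h, seqExp_const]

/-- If the fibres of `κ` are subcubes, in each of which the conditional expectation of `φ` is at
most `β`, then the expectation of `φ` is at most `β`. -/
theorem seqExp_le_of_fibres {U K : Type} [DecidableEq U] [Fintype K] [DecidableEq K]
    {q : U → ℝ} (hq : ∀ x, 0 ≤ q x ∧ q x ≤ 1) {l : List U} {φ : Finset U → ℝ} {β : ℝ}
    (κ : Finset U → K)
    (h : ∀ S₀, ∃ D A : Finset U, A ⊆ D ∧
      (∀ S, κ S = κ S₀ ↔ ∀ x ∈ D, (x ∈ S ↔ x ∈ A)) ∧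
      seqExp q (l.filter (· ∉ D)) φ A ≤ β) : seqExp q l φ ∅ ≤ β := by
  have hcell : ∀ k, seqExp q l (fun S => if κ S = k then φ S else 0) ∅ ≤
      seqExp q l (fun S => β * if κ S = k then 1 else 0) ∅ := by
    intro k
    by_cases hk : ∃ S₀, κ S₀ = k
    swap
    · push Not at hk
      simp [hk]
    obtain ⟨S₀, rfl⟩ := hk
    obtain ⟨D, A, hAD, hD, hle⟩ := h S₀
    have hperm : l.Perm (l.filter (· ∈ D) ++ l.filter (· ∉ D)) := by
      have := List.filter_append_perm (· ∈ D) l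
      simpa using this.symm
    rw [seqExp_perm q hperm, seqExp_perm q hperm, seqExp_append, seqExp_append]
    refine seqExp_mono hq fun T _ hT => ?_
    have hTD : T ⊆ D := fun x hx => by
      have := hT hx
      simp only [Finset.empty_union, List.mem_toFinset, List.mem_filter, decide_eq_true_eq] at this
      exact this.2
    have hinter : ∀ T', T ⊆ T' → T' ⊆ T ∪ (l.filter (· ∉ D)).toFinset →
        ∀ x ∈ D, (x ∈ T' ↔ x ∈ T) := by
      intro T' h1 h2 x hx
      refine ⟨fun hx' => ?_, fun hx' => h1 hx'⟩
      have := h2 hx'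
      simp only [Finset.mem_union, List.mem_toFinset, List.mem_filter, decide_eq_true_eq] at this
      exact this.resolve_right fun h => h.2 hx
    by_cases hTA : T = A
    · subst hTA
      have h1 : ∀ T', T ⊆ T' → T' ⊆ T ∪ (l.filter (· ∉ D)).toFinset → κ T' = κ S₀ :=
        fun T' h1 h2 => (hD T').2 (hinter T' h1 h2)
      refine (seqExp_congr hq (ψ := φ) fun T' h2 h3 => if_pos (h1 T' h2 h3)).trans_le
        (hle.trans (le_of_eq ?_))
      rw [seqExp_congr hq (ψ := fun _ => β) fun T' h2 h3 => by rw [if_pos (h1 T' h2 h3), mul_one],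
        seqExp_const]
    · have h1 : ∀ T', T ⊆ T' → T' ⊆ T ∪ (l.filter (· ∉ D)).toFinset → ¬ κ T' = κ S₀ := by
        intro T' h1 h2 hκ
        refine hTA (Finset.ext fun x => ?_)
        by_cases hx : x ∈ D
        · rw [← hinter T' h1 h2 x hx]; exact (hD T').1 hκ x hx
        · exact ⟨fun h => absurd (hTD h) hx, fun h => absurd (hAD h) hx⟩
      rw [seqExp_eq_zero hq fun T' h2 h3 => if_neg (h1 T' h2 h3),
        seqExp_eq_zero hq fun T' h2 h3 => by rw [if_neg (h1 T' h2 h3), mul_zero]]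
  have hsum := Finset.sum_le_sum fun k (_ : k ∈ (Finset.univ : Finset K)) => hcell k
  rw [← seqExp_sum, ← seqExp_sum] at hsum
  simpa [seqExp_const] using hsum

/-- Adding a random set under a map that forgets some elements of the list. -/
theorem seqExp_comp {U : Type} [DecidableEq U] (q : U → ℝ) {l : List U} {r : U → Bool}
    {h : Finset U → Finset U}
    (hh : ∀ x ∈ l, ∀ R, h (insert x R) = if r x then insert x (h R) else h R)
    (φ : Finset U → ℝ) (R : Finset U) :
    seqExp q l (fun T => φ (h T)) R = seqExp q (l.filter r) φ (h R) := by
  induction l generalizing R with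
  | nil => rfl
  | cons x l ih =>
    have ih := ih fun y hy => hh y (List.mem_cons_of_mem _ hy)
    rw [seqExp, ih, ih, hh x List.mem_cons_self]
    by_cases hx : r x
    · rw [List.filter_cons_of_pos hx, if_pos hx, seqExp]
    · rw [List.filter_cons_of_neg hx, if_neg hx]; ring

/-! ### The leaves of the two-stage decomposition -/

section Leaf

variable {U : Type} [Fintype U] [LinearOrder U]

/-- The piece of `S` in the first stage. -/
noncomputable def leafOne (O : Finset U → ℝ) (γ : ℝ) (S : Finset U) : Piece U :=
  pieceOf O γ (universeList U) (scan O (γ / 3) S (universeList U) (∅, ∅)).1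

/-- The piece of `P.dom \ S` in the second stage. -/
noncomputable def leafIn (O : Finset U → ℝ) (γ : ℝ) (P : Piece U) (S : Finset U) : Piece U :=
  pieceOf (complementFn O P) γ (groundList P)
    (scan (complementFn O P) (γ / 3) (P.dom \ S) (groundList P) (∅, ∅)).1

/-- The piece of `S` in the second stage. -/
noncomputable def leafTwo (O : Finset U → ℝ) (γ : ℝ) (S : Finset U) : Piece U :=
  leafIn O γ (leafOne O γ S) S

/-- The elements whose membership is determined by a pair of pieces. -/
def decided (P Q : Piece U) : Finset U := P.base ∪ P.rej ∪ (Q.base ∪ Q.rej)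

/-- The elements that are members of all sets of a pair of pieces. -/
def forced (P Q : Piece U) : Finset U := P.base ∪ Q.rej

theorem forced_subset_decided (P Q : Piece U) : forced P Q ⊆ decided P Q := by
  intro x; simp only [forced, decided, Finset.mem_union]; tauto

/-- The elements that the algorithm samples. -/
def sampled (P Q : Piece U) : Finset U := (P.dom ∩ Q.dom) \ (P.rej ∪ Q.rej)

/-- The argument of the oracle for the sample `R`. -/
def samplePoint (P Q : Piece U) (R : Finset U) : Finset U := ((R ∪ Q.rej) \ Q.base) ∪ P.base

variable {O f : Finset U → ℝ} {γ τ : ℝ}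

theorem scan_eq_leafOne (S : Finset U) :
    scan O (γ / 3) S (universeList U) (∅, ∅) = ((leafOne O γ S).base, (leafOne O γ S).rej) := by
  simp only [leafOne, pieceOf, scan_scan_fst]

theorem scan_eq_leafIn (P : Piece U) (S : Finset U) :
    scan (complementFn O P) (γ / 3) (P.dom \ S) (groundList P) (∅, ∅) =
      ((leafIn O γ P S).base, (leafIn O γ P S).rej) := by
  simp only [leafIn, pieceOf, scan_scan_fst]

theorem leafOne_base_subset (S : Finset U) : (leafOne O γ S).base ⊆ S := by
  have := scan_fst_subset (g := O) (θ := γ / 3) S (universeList U) (∅, ∅)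
  rw [scan_eq_leafOne] at this
  intro x hx
  simpa [mem_universeList] using this hx

theorem notMem_of_mem_leafOne_rej {S : Finset U} {x : U} (h : x ∈ (leafOne O γ S).rej) :
    x ∉ S := by
  have := scan_snd_subset (g := O) (θ := γ / 3) S (universeList U) (∅, ∅)
  rw [scan_eq_leafOne] at this
  simpa [mem_universeList] using this h

theorem mem_of_mem_leafIn_base {P : Piece U} {S : Finset U} {x : U}
    (h : x ∈ (leafIn O γ P S).base) : x ∈ P.dom ∧ x ∉ S := by
  have := scan_fst_subset (g := complementFn O P) (θ := γ / 3) (P.dom \ S) (groundList P) (∅, ∅)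
  rw [scan_eq_leafIn] at this
  have := this h
  simp [mem_groundList] at this
  exact this.1

theorem mem_of_mem_leafIn_rej {P : Piece U} {S : Finset U} {x : U}
    (h : x ∈ (leafIn O γ P S).rej) : x ∈ P.dom ∧ x ∈ S := by
  have := scan_snd_subset (g := complementFn O P) (θ := γ / 3) (P.dom \ S) (groundList P) (∅, ∅)
  rw [scan_eq_leafIn] at this
  have := this h
  simp [mem_groundList] at this
  exact ⟨this.1, this.2 this.1⟩

theorem mem_iff_mem_forced {S : Finset U} {x : U}
    (hx : x ∈ decided (leafOne O γ S) (leafTwo O γ S)) :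
    x ∈ S ↔ x ∈ forced (leafOne O γ S) (leafTwo O γ S) := by
  simp only [decided, forced, Finset.mem_union] at hx ⊢
  have h1 : x ∈ (leafOne O γ S).base → x ∈ S := fun h => leafOne_base_subset S h
  have h2 : x ∈ (leafOne O γ S).rej → x ∉ S := notMem_of_mem_leafOne_rej
  have h3 : x ∈ (leafTwo O γ S).base → x ∉ S := fun h => (mem_of_mem_leafIn_base h).2
  have h4 : x ∈ (leafTwo O γ S).rej → x ∈ S := fun h => (mem_of_mem_leafIn_rej h).2
  tauto

theorem leaf_congr {S S' : Finset U}
    (h : ∀ x ∈ decided (leafOne O γ S) (leafTwo O γ S), (x ∈ S' ↔ x ∈ S)) :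
    leafOne O γ S' = leafOne O γ S ∧ leafTwo O γ S' = leafTwo O γ S := by
  have h1 : leafOne O γ S' = leafOne O γ S := by
    rw [leafOne, scan_congr (S := S), ← leafOne]
    intro x hx
    rw [scan_eq_leafOne] at hx
    exact (h x (Finset.mem_union_left _ hx)).symm
  refine ⟨h1, ?_⟩
  rw [leafTwo, h1, leafIn, scan_congr (S := (leafOne O γ S).dom \ S), ← leafIn, ← leafTwo]
  intro x hx
  rw [scan_eq_leafIn] at hx
  rw [Finset.mem_sdiff, Finset.mem_sdiff, h x (Finset.mem_union_right _ hx)]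

theorem leaf_eq_iff {S S' : Finset U} :
    ((leafOne O γ S').base, (leafTwo O γ S').base) =
        ((leafOne O γ S).base, (leafTwo O γ S).base) ↔
      ∀ x ∈ decided (leafOne O γ S) (leafTwo O γ S),
        (x ∈ S' ↔ x ∈ forced (leafOne O γ S) (leafTwo O γ S)) := by
  constructor
  · intro h x hx
    rw [Prod.mk.injEq] at h
    have h1 : leafOne O γ S' = leafOne O γ S := by
      have : ∀ S, leafOne O γ S = pieceOf O γ (universeList U) (leafOne O γ S).base :=
        fun S => rfl
      rw [this S', this S, h.1]
    have h2 : leafTwo O γ S' = leafTwo O γ S := by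
      have : ∀ S, leafTwo O γ S = pieceOf (complementFn O (leafOne O γ S)) γ
        (groundList (leafOne O γ S)) (leafTwo O γ S).base := fun S => rfl
      rw [this S', this S, h.2, h1]
    rw [← h1, ← h2] at hx ⊢
    exact mem_iff_mem_forced hx
  · intro h
    have := leaf_congr (S := S) (S' := S') fun x hx => by rw [h x hx, mem_iff_mem_forced hx]
    rw [this.1, this.2]

theorem abs_marg_sub_le (hO : ∀ S, |O S - f S| ≤ τ) (S T : Finset U) :
    O S - O T ≤ f S - f T + 2 * τ ∧ f S - f T ≤ O S - O T + 2 * τ := by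
  have h1 := abs_le.1 (hO S)
  have h2 := abs_le.1 (hO T)
  constructor <;> linarith

/-- The properties of an element that the decomposition leaves undecided at the leaf of `S`. -/
theorem undecided_spec (hf : IsSubmodular f) (hO : ∀ S, |O S - f S| ≤ τ) (hγ : γ = 12 * τ)
    {S : Finset U} {x : U} (hx : x ∉ decided (leafOne O γ S) (leafTwo O γ S)) :
    x ∈ (leafOne O γ S).dom ∧ x ∈ (leafTwo O γ S).dom ∧
    f (insert x (leafOne O γ S).base) - f (leafOne O γ S).base ≤ 6 * τ ∧
    ∀ T, x ∉ T → T ⊆ ((leafOne O γ S).dom \ (leafTwo O γ S).base) ∪ (leafOne O γ S).base →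
      -(6 * τ) ≤ f (insert x T) - f T := by
  simp only [decided, Finset.mem_union, not_or] at hx
  obtain ⟨⟨hxB, hxR⟩, hxC, hxT⟩ := hx
  have hfB : f (insert x (leafOne O γ S).base) - f (leafOne O γ S).base ≤ 6 * τ := by
    have := exists_marg_le_of_notMem_scan (g := O) (θ := γ / 3) (S := S) (s := (∅, ∅))
      (mem_universeList x) (by rwa [scan_eq_leafOne]) (by rwa [scan_eq_leafOne])
    rw [scan_eq_leafOne] at this
    obtain ⟨B', hB', hm⟩ := this
    have h1 := hf.marginal_le hB' hxB
    have h2 := (abs_marg_sub_le hO (insert x B') B').2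
    unfold marg at hm
    linarith
  have hdom : x ∈ (leafOne O γ S).dom := by
    have := (abs_marg_sub_le hO (insert x (leafOne O γ S).base) (leafOne O γ S).base).1
    have : x ∈ lowSet O (2 * γ / 3) (universeList U) (leafOne O γ S).base := by
      simp only [lowSet, List.mem_toFinset, List.mem_filter, mem_universeList, true_and,
        decide_eq_true_eq]
      unfold marg
      linarith
    exact this
  set P := leafOne O γ S with hP
  have hlow : ∀ T, x ∉ T → T ⊆ (P.dom \ (leafTwo O γ S).base) ∪ P.base →
      -(6 * τ) ≤ f (insert x T) - f T := by
    intro T hxT' hT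
    have := exists_marg_le_of_notMem_scan (g := complementFn O P) (θ := γ / 3) (S := P.dom \ S)
      (s := (∅, ∅)) (mem_groundList.2 hdom) (by rw [scan_eq_leafIn]; exact hxC)
      (by rw [scan_eq_leafIn]; exact hxT)
    rw [scan_eq_leafIn] at this
    obtain ⟨C', hC', hm⟩ := this
    change C' ⊆ (leafTwo O γ S).base at hC'
    have hxC' : x ∉ C' := fun h => hxC (hC' h)
    unfold marg complementFn at hm
    have hins : P.dom \ C' ∪ P.base = insert x (P.dom \ insert x C' ∪ P.base) := by
      ext y
      by_cases hy : y = x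
      · subst hy; simp [hdom, hxC']
      · simp [hy]
    have hnot : x ∉ P.dom \ insert x C' ∪ P.base := by simp [hxB]
    have hsub : T ⊆ P.dom \ insert x C' ∪ P.base := by
      intro y hy
      have hyx : y ≠ x := fun h => hxT' (h ▸ hy)
      have := hT hy
      simp only [Finset.mem_union, Finset.mem_sdiff, Finset.mem_insert, hyx, false_or] at this ⊢
      exact this.imp_left fun h => ⟨h.1, fun h' => h.2 (hC' h')⟩
    have h1 := hf.marginal_le hsub hnot
    have h2 := (abs_marg_sub_le hO (P.dom \ insert x C' ∪ P.base) (P.dom \ C' ∪ P.base)).2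
    rw [← hins] at h1
    linarith
  refine ⟨hdom, ?_, hfB, hlow⟩
  set C := (leafTwo O γ S).base with hC
  have hins : P.dom \ C ∪ P.base = insert x (P.dom \ insert x C ∪ P.base) := by
    ext y
    by_cases hy : y = x
    · subst hy; simp [hdom, hxC]
    · simp [hy]
  have h1 := hlow (P.dom \ insert x C ∪ P.base) (by simp [hxB])
    (by rw [hins]; exact Finset.subset_insert _ _)
  have h2 := (abs_marg_sub_le hO (P.dom \ insert x C ∪ P.base) (P.dom \ C ∪ P.base)).1
  rw [← hins] at h1
  have : x ∈ lowSet (complementFn O P) (2 * γ / 3) (groundList P) C := by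
    simp only [lowSet, List.mem_toFinset, List.mem_filter, mem_groundList, hdom, true_and,
      decide_eq_true_eq]
    unfold marg complementFn
    linarith
  exact this

/-- The mean of `φ` at the pair `(P, Q)`, as seen by the sampling algorithm. -/
noncomputable def pairMean (p : U → unitInterval) (φ : Finset U → ℝ) (P Q : Piece U) : ℝ :=
  seqExp (fun x => (p x : ℝ)) ((universeList U).filter (· ∈ sampled P Q))
    (fun R => φ (samplePoint P Q R)) ∅

theorem pairMean_leaf (hf : IsSubmodular f) (hO : ∀ S, |O S - f S| ≤ τ) (hγ : γ = 12 * τ)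
    (p : U → unitInterval) (φ : Finset U → ℝ) (S : Finset U) :
    pairMean p φ (leafOne O γ S) (leafTwo O γ S) =
      seqExp (fun x => (p x : ℝ))
        ((universeList U).filter (· ∉ decided (leafOne O γ S) (leafTwo O γ S))) φ
        (forced (leafOne O γ S) (leafTwo O γ S)) := by
  have hundec := fun x => undecided_spec hf hO hγ (S := S) (x := x)
  have hBC : ∀ x, x ∈ (leafTwo O γ S).base → x ∉ (leafOne O γ S).base :=
    fun x h h' => (mem_of_mem_leafIn_base h).2 (leafOne_base_subset S h')
  have hRC : ∀ x, x ∈ (leafTwo O γ S).rej → x ∉ (leafTwo O γ S).base :=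
    fun x h h' => (mem_of_mem_leafIn_base h').2 (mem_of_mem_leafIn_rej h).2
  set P := leafOne O γ S
  set Q := leafTwo O γ S
  have hforced : samplePoint P Q ∅ = forced P Q := by
    ext x
    have := hRC x
    simp only [samplePoint, forced, Finset.empty_union, Finset.mem_union, Finset.mem_sdiff]
    tauto
  rw [pairMean, seqExp_comp _ (r := fun x => x ∉ decided P Q), hforced, List.filter_filter]
  · congr 1
    refine List.filter_congr fun x _ => ?_
    by_cases hx : x ∈ decided P Q
    · simp [hx]
    · have h := hundec x hx
      have : x ∈ sampled P Q := by
        simp only [decided, Finset.mem_union, not_or] at hx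
        simp [sampled, h.1, h.2.1, hx]
      simp [hx, this]
  · intro x hx R
    have hx : x ∈ sampled P Q := by simpa using (List.mem_filter.1 hx).2
    by_cases hd : x ∈ decided P Q
    · have : x ∈ P.base ∨ x ∈ Q.base := by
        simp only [sampled, decided, Finset.mem_union, Finset.mem_sdiff] at hx hd
        tauto
      rw [if_neg (by simpa using hd)]
      ext y
      simp only [samplePoint, Finset.mem_union, Finset.mem_sdiff, Finset.mem_insert]
      by_cases hy : y = x
      · subst hy; tauto
      · simp [hy]
    · rw [if_pos (by simpa using hd)]
      simp only [decided, Finset.mem_union, not_or] at hd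
      ext y
      simp only [samplePoint, Finset.mem_union, Finset.mem_sdiff, Finset.mem_insert]
      by_cases hy : y = x
      · subst hy; tauto
      · simp [hy]

open Classical in
/-- Within a leaf, `f` is concentrated around its mean. -/
theorem leaf_deviation_le (hf : IsSubmodular f) (hf01 : ∀ S, f S ∈ Set.Icc (0 : ℝ) 1)
    (hO : ∀ S, |O S - f S| ≤ τ) (hτ : 0 < τ) (hγ : γ = 12 * τ)
    (p : U → unitInterval) {t : ℝ} (ht : 0 ≤ t) (ht3 : t ≤ 3) :
    seqExp (fun x => (p x : ℝ)) (universeList U) (fun S =>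
      if |f S - pairMean p f (leafOne O γ S) (leafTwo O γ S)| ≤ t then 0 else 1) ∅ ≤
      2 * Real.exp (-(t ^ 2 / (36 * τ))) := by
  have hp : ∀ x, (0 : ℝ) ≤ p x ∧ (p x : ℝ) ≤ 1 := fun x => (p x).2
  refine seqExp_le_of_fibres hp
    (fun S => ((leafOne O γ S).base, (leafTwo O γ S).base)) fun S₀ => ?_
  refine ⟨decided (leafOne O γ S₀) (leafTwo O γ S₀), forced (leafOne O γ S₀) (leafTwo O γ S₀),
    forced_subset_decided _ _, fun S => leaf_eq_iff, ?_⟩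
  have hundec := fun x => undecided_spec hf hO hγ (S := S₀) (x := x)
  have hmean := pairMean_leaf hf hO hγ p f S₀
  have hleaf : ∀ T, forced (leafOne O γ S₀) (leafTwo O γ S₀) ⊆ T →
      T ⊆ forced (leafOne O γ S₀) (leafTwo O γ S₀) ∪
        ((universeList U).filter (· ∉ decided (leafOne O γ S₀) (leafTwo O γ S₀))).toFinset →
      leafOne O γ T = leafOne O γ S₀ ∧ leafTwo O γ T = leafTwo O γ S₀ := by
    intro T h1 h2
    refine leaf_congr fun x hx => ?_
    rw [mem_iff_mem_forced hx]
    refine ⟨fun h => ?_, fun h => h1 h⟩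
    have := h2 h
    simp only [Finset.mem_union, List.mem_toFinset, List.mem_filter, decide_eq_true_eq] at this
    exact this.resolve_right fun h => h.2 hx
  have hforced : forced (leafOne O γ S₀) (leafTwo O γ S₀) ⊆
      ((leafOne O γ S₀).dom \ (leafTwo O γ S₀).base) ∪ (leafOne O γ S₀).base := by
    intro x hx
    rcases Finset.mem_union.1 hx with h | h
    · exact Finset.mem_union_right _ h
    · refine Finset.mem_union_left _ (Finset.mem_sdiff.2 ⟨(mem_of_mem_leafIn_rej h).1, fun h' => ?_⟩)
      exact (mem_of_mem_leafIn_base h').2 (mem_of_mem_leafIn_rej h).2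
  rw [seqExp_congr hp (ψ := fun S => if |f S - pairMean p f (leafOne O γ S₀) (leafTwo O γ S₀)| ≤ t
    then 0 else 1) fun T h1 h2 => by rw [(hleaf T h1 h2).1, (hleaf T h1 h2).2]]
  set P := leafOne O γ S₀
  set Q := leafTwo O γ S₀
  rw [hmean]
  have hdev := seqExp_deviation_le hf hf01 hp (c := 6 * τ) (by positivity) ht ht3
    (l := (universeList U).filter (· ∉ decided P Q)) (S := forced P Q)
    (nodup_universeList.filter _) ?_ ?_
  · refine hdev.trans (le_of_eq ?_)
    congr 4; ring
  · intro x hx h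
    have := (List.mem_filter.1 hx).2
    simp only [decide_eq_true_eq] at this
    exact this (forced_subset_decided _ _ h)
  · intro x hx T h1 h2 h3
    have hx : x ∉ decided P Q := by simpa using (List.mem_filter.1 hx).2
    obtain ⟨_, _, hB, hlow⟩ := hundec x hx
    rw [abs_le]
    constructor
    · refine hlow T h3 (h2.trans ?_)
      refine Finset.union_subset hforced fun y hy => ?_
      have hy : y ∉ decided P Q := by
        simpa using (List.mem_filter.1 (List.mem_toFinset.1 hy)).2
      have hydom := (hundec y hy).1
      simp only [decided, Finset.mem_union, not_or] at hy
      exact Finset.mem_union_left _ (Finset.mem_sdiff.2 ⟨hydom, hy.2.1⟩)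
    · exact (hf.marginal_le (Finset.subset_union_left.trans h1) h3).trans hB

/-- A function that is close to the mean of each leaf approximates `f`. -/
theorem approximates_of_leaf (hf : IsSubmodular f) (hf01 : ∀ S, f S ∈ Set.Icc (0 : ℝ) 1)
    (hO : ∀ S, |O S - f S| ≤ τ) (hτ : 0 < τ) (hγ : γ = 12 * τ)
    (p : U → unitInterval) {t η α β : ℝ} (ht : 0 ≤ t) (ht3 : t ≤ 3) (hα : t + η ≤ α)
    (hβ : 2 * Real.exp (-(t ^ 2 / (36 * τ))) ≤ β) {h : Finset U → ℝ}
    (hh : ∀ S, |h S - pairMean p f (leafOne O γ S) (leafTwo O γ S)| ≤ η) :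
    Approximates α β p f h := by
  classical
  have hp : ∀ x, (0 : ℝ) ≤ p x ∧ (p x : ℝ) ≤ 1 := fun x => (p x).2
  have hdev := (leaf_deviation_le hf hf01 hO hτ hγ p ht ht3).trans hβ
  rw [Approximates, productProb_eq_seqExp]
  have : seqExp (fun x => (p x : ℝ)) (universeList U) (fun S => (1 : ℝ) -
      if |f S - pairMean p f (leafOne O γ S) (leafTwo O γ S)| ≤ t then 0 else 1) ∅ ≤
      seqExp (fun x => (p x : ℝ)) (universeList U)
        (fun S => if |f S - h S| ≤ α then 1 else 0) ∅ := by
    refine seqExp_mono hp fun S _ _ => ?_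
    split_ifs with h1 h2 h2
    · simp
    · refine absurd ?_ h2
      have h3 := abs_sub_le (f S) (pairMean p f (leafOne O γ S) (leafTwo O γ S)) (h S)
      have h4 := hh S
      rw [abs_sub_comm] at h4
      linarith
    · simp
    · simp
  rw [seqExp_sub, seqExp_const] at this
  linarith

end Leaf

/-! ### Estimation of the means -/

section Estimation

variable {U : Type} [Fintype U] [LinearOrder U] {O f : Finset U → ℝ}

open Prog

theorem Prog.expect_arith {A : Type} (g : A → ℝ) (a : A) :
    (arith (U := U) a).expect O g = g a := rfl

theorem Prog.expect_setOp {A : Type} (g : A → ℝ) (a : A) :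
    (setOp (U := U) a).expect O g = g a := rfl

theorem Prog.expect_ask (g : ℝ → ℝ) (S : Finset U) : (ask S).expect O g = g (O S) := rfl

theorem Prog.expect_pure {A : Type} (g : A → ℝ) (a : A) :
    (pure a : Prog U A).expect O g = g a := rfl

theorem Prog.expect_toss {A : Type} (g : A → ℝ) (q : unitInterval) (k : Bool → Prog U A) :
    (toss q k).expect O g =
      (q : ℝ) * (k true).expect O g + (1 - (q : ℝ)) * (k false).expect O g := rfl

theorem Prog.expect_ret {A : Type} (g : A → ℝ) (a : A) :
    (Prog.ret a : Prog U A).expect O g = g a := rfl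

theorem expect_sampleSubset (p : U → unitInterval) (W : Finset U) (ψ : Finset U → ℝ) :
    (sampleSubset p W).expect O ψ =
      seqExp (fun x => (p x : ℝ)) ((universeList U).filter (· ∈ W)) ψ ∅ := by
  unfold sampleSubset
  generalize universeList U = l
  generalize (∅ : Finset U) = R
  induction l generalizing R with
  | nil => rfl
  | cons x l ih =>
    rw [List.foldlM_cons, expect_bind]
    simp only [ih]
    by_cases hx : x ∈ W
    · rw [List.filter_cons_of_pos (by simpa using hx)]
      simp only [expect_bind, expect_arith, hx, decide_true, if_true, expect_toss, expect_ret,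
        expect_setOp, Bool.false_eq_true, if_false, expect_pure, seqExp]
    · rw [List.filter_cons_of_neg (by simpa using hx)]
      simp only [expect_bind, expect_arith, hx, decide_false, Bool.false_eq_true, if_false,
        expect_pure]

theorem ensures_sampleSubset (p : U → unitInterval) (W : Finset U) :
    (sampleSubset p W).Ensures O (Fintype.card U * (Fintype.card U + 3)) fun _ => True := by
  unfold sampleSubset
  rw [← length_universeList]
  refine Ensures.foldlM_time ∅ fun x _ R => ?_
  rw [length_universeList]
  refine (ensures_arith _).bind_eq (t₂ := Fintype.card U + 2) ?_ (by omega)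
  split_ifs
  · refine Ensures.bind (Q := fun _ => True) (t₁ := 1) (t₂ := Fintype.card U + 1)
      ⟨by simp [time], fun _ _ => trivial⟩ (fun b _ => ?_) (by omega)
    split_ifs
    · exact (ensures_setOp _).mono le_rfl fun _ _ => trivial
    · exact Ensures.pure trivial
  · exact Ensures.pure trivial

/-- The sum of the oracle's answers for one sample per element of a list. -/
noncomputable def sampleSum (p : U → unitInterval) (P Q : Piece U) (l : List ℕ) (acc : ℝ) :
    Prog U ℝ :=
  l.foldlM (fun (acc : ℝ) _ => do
    let R ← sampleSubset p (sampled P Q)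
    let S₁ ← Prog.setOp (R ∪ Q.rej)
    let S₂ ← Prog.setOp (S₁ \ Q.base)
    let S ← Prog.setOp (S₂ ∪ P.base)
    let v ← Prog.ask S
    Prog.arith (acc + v)) acc

theorem expect_estimate (p : U → unitInterval) (m : ℕ) (P Q : Piece U) (g : ℝ → ℝ) :
    (estimate p m P Q).expect O g =
      (sampleSum p P Q (List.range m) 0).expect O fun v => g (v / m) := by
  unfold estimate
  simp only [expect_bind, expect_setOp, expect_arith]
  rfl

theorem ensures_estimate (p : U → unitInterval) (m : ℕ) (P Q : Piece U) :
    (estimate p m P Q).Ensures O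
      (3 * (Fintype.card U + 1) + m * (Fintype.card U * (Fintype.card U + 3) +
        3 * (Fintype.card U + 1) + 2) + 1) fun _ => True := by
  unfold estimate
  refine (ensures_setOp _).bind_eq ((ensures_setOp _).bind_eq ((ensures_setOp _).bind_eq
    (Ensures.bind (Q := fun _ => True) (t₁ := m * (Fintype.card U * (Fintype.card U + 3) +
        3 * (Fintype.card U + 1) + 2)) (t₂ := 1) ?_ (fun _ _ =>
          (ensures_arith _).mono le_rfl fun _ _ => trivial) le_rfl) le_rfl) le_rfl) (by omega)
  have := Ensures.foldlM_time (O := O) (t := Fintype.card U * (Fintype.card U + 3) +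
        3 * (Fintype.card U + 1) + 2) (l := List.range m) (f := fun (acc : ℝ) (_ : ℕ) => do
    let R ← sampleSubset p ((P.dom ∩ Q.dom) \ (P.rej ∪ Q.rej))
    let S₁ ← Prog.setOp (R ∪ Q.rej)
    let S₂ ← Prog.setOp (S₁ \ Q.base)
    let S ← Prog.setOp (S₂ ∪ P.base)
    let v ← Prog.ask S
    Prog.arith (acc + v)) 0 fun _ _ acc =>
      (ensures_sampleSubset p _).bind (fun R _ => (ensures_setOp _).bind_eq
        ((ensures_setOp _).bind_eq ((ensures_setOp _).bind_eq ((ensures_ask _).bind_eq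
          ((ensures_arith _).mono le_rfl fun _ _ => trivial) le_rfl) le_rfl) le_rfl) le_rfl)
        (by omega)
  rwa [List.length_range] at this

theorem expect_exp_sampleSum_le (p : U → unitInterval) (P Q : Piece U) (l : List ℕ) (acc s : ℝ)
    {M : ℝ} (hM : pairMean p (fun S => Real.exp (s * O S)) P Q ≤ M) :
    (sampleSum p P Q l acc).expect O (fun v => Real.exp (s * v)) ≤
      Real.exp (s * acc) * M ^ l.length := by
  have hM0 : 0 ≤ M := (seqExp_nonneg (fun x => (p x).2) (fun _ => (Real.exp_pos _).le) _).trans hM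
  induction l generalizing acc with
  | nil => simp [sampleSum, expect_pure]
  | cons a l ih =>
    rw [sampleSum, List.foldlM_cons, expect_bind]
    simp only [expect_bind, expect_setOp, expect_arith, expect_ask, expect_sampleSubset]
    refine (seqExp_mono (fun x => (p x).2) fun R _ _ => ih _).trans ?_
    have : ∀ R : Finset U, Real.exp (s * (acc + O ((R ∪ Q.rej) \ Q.base ∪ P.base))) * M ^ l.length =
        (Real.exp (s * acc) * M ^ l.length) * Real.exp (s * O (samplePoint P Q R)) := by
      intro R; rw [mul_add, Real.exp_add, samplePoint]; ring
    simp only [this]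
    rw [seqExp_mul_left, List.length_cons, pow_succ, ← mul_assoc]
    exact mul_le_mul_of_nonneg_left hM (by positivity)

theorem pairMean_exp_le (hf01 : ∀ S, f S ∈ Set.Icc (0 : ℝ) 1) {τ : ℝ}
    (hO : ∀ S, |O S - f S| ≤ τ) (p : U → unitInterval) (P Q : Piece U) {s : ℝ} (hs : |s| ≤ 1) :
    pairMean p (fun S => Real.exp (s * O S)) P Q ≤
      Real.exp (s * pairMean p f P Q + |s| * τ + 3 / 16 * s ^ 2) := by
  have hp : ∀ x, (0 : ℝ) ≤ p x ∧ (p x : ℝ) ≤ 1 := fun x => (p x).2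
  set μ := pairMean p f P Q with hμ
  have hμ0 : 0 ≤ μ := seqExp_nonneg hp (fun S => (hf01 _).1) _
  have hμ1 : μ ≤ 1 := by
    have := seqExp_mono hp (l := (universeList U).filter (· ∈ sampled P Q)) (S := ∅)
      (φ := fun R => f (samplePoint P Q R)) (ψ := fun _ => 1) fun T _ _ => (hf01 _).2
    rwa [seqExp_const] at this
  have hpt : ∀ S, Real.exp (s * O S) ≤
      Real.exp (|s| * τ) * (1 + (Real.exp s - 1) * f S) := by
    intro S
    have h1 : s * O S ≤ |s| * τ + s * f S := by
      have := (le_abs_self (s * (O S - f S))).trans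
        ((abs_mul _ _).le.trans (mul_le_mul_of_nonneg_left (hO S) (abs_nonneg s)))
      linarith
    have h2 : Real.exp (s * f S) ≤ 1 + (Real.exp s - 1) * f S := by
      have := convexOn_exp.2 (Set.mem_univ 0) (Set.mem_univ s) (sub_nonneg.2 (hf01 S).2)
        (hf01 S).1 (by ring)
      simp only [smul_eq_mul, mul_zero, zero_add, Real.exp_zero, mul_one] at this
      rw [mul_comm s]
      linarith
    calc _ ≤ Real.exp (|s| * τ + s * f S) := Real.exp_le_exp.2 h1
      _ = Real.exp (|s| * τ) * Real.exp (s * f S) := Real.exp_add _ _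
      _ ≤ _ := mul_le_mul_of_nonneg_left h2 (Real.exp_pos _).le
  have h1 : pairMean p (fun S => Real.exp (s * O S)) P Q ≤
      Real.exp (|s| * τ) * (1 + (Real.exp s - 1) * μ) := by
    refine (seqExp_mono hp fun R _ _ => hpt _).trans (le_of_eq ?_)
    rw [seqExp_mul_left, seqExp_add, seqExp_const, seqExp_mul_left, hμ, pairMean]
  have h2 := two_point_exp_le (a := 1) (b := 0) (s := s) hμ0 hμ1 (by simpa using hs)
  have h3 : Real.exp (s * (μ * 1 + (1 - μ) * 0) + 3 / 4 * s ^ 2 * (μ * (1 - μ) * (1 - 0) ^ 2)) ≤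
      Real.exp (s * μ + 3 / 16 * s ^ 2) := by
    refine Real.exp_le_exp.2 ?_
    nlinarith [mul_nonneg (sq_nonneg s) (sq_nonneg (2 * μ - 1))]
  have h4 : 1 + (Real.exp s - 1) * μ ≤ Real.exp (s * μ + 3 / 16 * s ^ 2) := by
    refine le_trans (le_of_eq ?_) (h2.trans h3)
    simp only [mul_one, mul_zero, Real.exp_zero]; ring
  refine h1.trans ((mul_le_mul_of_nonneg_left h4 (Real.exp_pos _).le).trans (le_of_eq ?_))
  rw [← Real.exp_add]; congr 1; ring

theorem prob_estimate_ge (hf01 : ∀ S, f S ∈ Set.Icc (0 : ℝ) 1) {τ : ℝ}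
    (hO : ∀ S, |O S - f S| ≤ τ) (p : U → unitInterval) (P Q : Piece U) {m : ℕ} (hm : 0 < m)
    {ε : ℝ} (hε : 0 ≤ ε) (hε' : ε ≤ 3 / 8) :
    1 - 2 * Real.exp (-(4 / 3 * ε ^ 2 * m)) ≤
      (estimate p m P Q).prob O fun v => |v - pairMean p f P Q| ≤ ε + τ := by
  classical
  set μ := pairMean p f P Q with hμ
  have hm' : (0 : ℝ) < m := Nat.cast_pos.2 hm
  have hmgf : ∀ s : ℝ, |s| ≤ 1 →
      (sampleSum p P Q (List.range m) 0).expect O (fun v => Real.exp (s * v)) ≤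
        Real.exp (m * (s * μ + |s| * τ + 3 / 16 * s ^ 2)) := by
    intro s hs
    have := expect_exp_sampleSum_le p P Q (List.range m) 0 s (pairMean_exp_le hf01 hO p P Q hs)
    rwa [mul_zero, Real.exp_zero, one_mul, List.length_range, ← Real.exp_nat_mul] at this
  set s := 8 * ε / 3 with hs
  have hs0 : 0 ≤ s := by positivity
  have hs1 : s ≤ 1 := by rw [hs]; linarith
  have h1 := hmgf s (by rwa [abs_of_nonneg hs0])
  have h2 := hmgf (-s) (by rwa [abs_neg, abs_of_nonneg hs0])
  rw [abs_of_nonneg hs0] at h1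
  rw [abs_neg, abs_of_nonneg hs0] at h2
  rw [prob_eq_expect, expect_estimate]
  have key : (sampleSum p P Q (List.range m) 0).expect O (fun v => 1 +
      (-Real.exp (-(s * m * (μ + ε + τ))) * Real.exp (s * v) +
        -Real.exp (s * m * (μ - ε - τ)) * Real.exp (-s * v))) ≤
      (sampleSum p P Q (List.range m) 0).expect O
        fun v => if |v / m - μ| ≤ ε + τ then 1 else 0 := by
    refine expect_mono fun v _ => ?_
    rw [neg_mul, neg_mul, ← Real.exp_add, ← Real.exp_add]
    have e1 := Real.exp_pos (-(s * m * (μ + ε + τ)) + s * v)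
    have e2 := Real.exp_pos (s * m * (μ - ε - τ) + -s * v)
    split_ifs with h
    · linarith
    · have hv : v = m * (v / m) := by field_simp
      rw [abs_le, not_and_or, not_le, not_le] at h
      rcases h with h | h
      · have : 0 ≤ s * m * (μ - ε - τ) + -s * v := by
          rw [hv]
          have := mul_nonneg (mul_nonneg hs0 hm'.le) (by linarith : 0 ≤ μ - ε - τ - v / m)
          linarith
        linarith [Real.one_le_exp this]
      · have : 0 ≤ -(s * m * (μ + ε + τ)) + s * v := by
          rw [hv]
          have := mul_nonneg (mul_nonneg hs0 hm'.le) (by linarith : 0 ≤ v / m - (μ + ε + τ))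
          linarith
        linarith [Real.one_le_exp this]
  rw [expect_add, expect_const, expect_add, expect_mul_left, expect_mul_left] at key
  have e1 := mul_le_mul_of_nonneg_left h1 (Real.exp_pos (-(s * m * (μ + ε + τ)))).le
  have e2 := mul_le_mul_of_nonneg_left h2 (Real.exp_pos (s * m * (μ - ε - τ))).le
  rw [← Real.exp_add] at e1 e2
  have r1 : -(s * m * (μ + ε + τ)) + m * (s * μ + s * τ + 3 / 16 * s ^ 2) =
      -(4 / 3 * ε ^ 2 * m) := by rw [hs]; ring
  have r2 : s * m * (μ - ε - τ) + m * (-s * μ + s * τ + 3 / 16 * (-s) ^ 2) =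
      -(4 / 3 * ε ^ 2 * m) := by rw [hs]; ring
  rw [r1] at e1
  rw [r2] at e2
  linarith

end Estimation

/-! ### The output of the learning algorithm -/

section Output

variable {U : Type} [Fintype U] [LinearOrder U] {O : Finset U → ℝ} {γ : ℝ}

/-- The hypothesis `h` has the pairs of pieces of `G`, with estimates that satisfy `Acc`. -/
def Matches (Acc : Piece U → Piece U → ℝ → Prop) (G : List (Piece U × List (Piece U)))
    (h : Hypothesis U) : Prop :=
  List.Forall₂ (fun e e' => e'.1 = e.1 ∧
    List.Forall₂ (fun Q q => q.1 = Q ∧ Acc e.1 Q q.2) e.2 e'.2) G h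

/-- The pairs of pieces of the two-stage decomposition. -/
noncomputable def twoStages (O : Finset U → ℝ) (γ : ℝ) : List (Piece U × List (Piece U)) :=
  (stageOne O γ).map fun P => (P, stageTwo O γ P)

theorem List.Forall₂.exists_of_mem_left {A B : Type} {R : A → B → Prop} {l : List A} {l' : List B}
    (h : List.Forall₂ R l l') {a : A} (ha : a ∈ l) : ∃ b ∈ l', R a b := by
  induction h with
  | nil => simp at ha
  | cons hr _ ih =>
    rcases List.mem_cons.1 ha with rfl | ha
    · exact ⟨_, List.mem_cons_self, hr⟩
    · obtain ⟨b, hb, h⟩ := ih ha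
      exact ⟨b, List.mem_cons_of_mem _ hb, h⟩

theorem List.Forall₂.exists_of_mem_right {A B : Type} {R : A → B → Prop} {l : List A} {l' : List B}
    (h : List.Forall₂ R l l') {b : B} (hb : b ∈ l') : ∃ a ∈ l, R a b :=
  (h.flip).exists_of_mem_left hb

theorem leafOne_mem_stageOne (S : Finset U) : leafOne O γ S ∈ stageOne O γ :=
  List.mem_map_of_mem (scan_mem_enumSets S _ (List.mem_singleton.2 rfl))

theorem leafIn_mem_stageTwo (P : Piece U) (S : Finset U) : leafIn O γ P S ∈ stageTwo O γ P :=
  List.mem_map_of_mem (scan_mem_enumSets _ _ (List.mem_singleton.2 rfl))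

/-- A table of pieces finds the piece of `S`. -/
theorem lookup_locate {A : Type} {g : Finset U → ℝ} {xs : List U} {table : List (Piece U × A)}
    (h1 : ∀ e ∈ table, e.1 ∈ (enumSets g (γ / 3) xs [∅]).map (pieceOf g γ xs))
    (h2 : ∀ P ∈ (enumSets g (γ / 3) xs [∅]).map (pieceOf g γ xs), ∃ e ∈ table, e.1 = P)
    (S : Finset U) :
    ∃ e ∈ table, e.1 = pieceOf g γ xs (scan g (γ / 3) S xs (∅, ∅)).1 ∧
      (lookup table (locate table xs S).val).val = some e := by
  have hpiece : ∀ e ∈ table, e.1 = pieceOf g γ xs e.1.base := by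
    intro e he
    obtain ⟨B, _, hB⟩ := List.mem_map.1 (h1 e he)
    rw [← hB]; rfl
  have hall : ∀ B ∈ enumSets g (γ / 3) xs [∅], ∃ e ∈ table, e.1.base = B := by
    intro B hB
    obtain ⟨e, he, h⟩ := h2 _ (List.mem_map_of_mem hB)
    exact ⟨e, he, by rw [h]; rfl⟩
  rw [locate_val hpiece hall]
  obtain ⟨e, he, hb, hv⟩ := lookup_val
    (hall _ (scan_mem_enumSets S xs (s := (∅, ∅)) (List.mem_singleton.2 rfl)))
  exact ⟨e, he, by rw [hpiece e he, hb], hv⟩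

theorem Matches.acc_eval {Acc : Piece U → Piece U → ℝ → Prop} {h : Hypothesis U}
    (hh : Matches Acc (twoStages O γ) h) (S : Finset U) :
    Acc (leafOne O γ S) (leafTwo O γ S) (h.eval S).val := by
  have hrow : ∀ e ∈ h, e.1 ∈ stageOne O γ ∧
      List.Forall₂ (fun Q q => q.1 = Q ∧ Acc e.1 Q q.2) (stageTwo O γ e.1) e.2 := by
    intro e he
    obtain ⟨e', he', h1, h2⟩ := List.Forall₂.exists_of_mem_right hh he
    obtain ⟨P, hP, rfl⟩ := List.mem_map.1 he'
    rw [h1]; exact ⟨hP, h2⟩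
  obtain ⟨⟨P, table⟩, he, hP, hv⟩ := lookup_locate (g := O) (γ := γ) (table := h)
    (xs := universeList U) (fun e he => (hrow e he).1) (fun P hP => by
      obtain ⟨e, he, h1, -⟩ := List.Forall₂.exists_of_mem_left hh (List.mem_map_of_mem hP)
      exact ⟨e, he, h1⟩) S
  change P = leafOne O γ S at hP
  have htable := (hrow _ he).2
  subst hP
  obtain ⟨⟨Q, v⟩, hq, hQ, hv'⟩ := lookup_locate (g := complementFn O (leafOne O γ S)) (γ := γ)
    (table := table) (xs := groundList (leafOne O γ S))
    (fun q hq => by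
      obtain ⟨Q, hQ, h1, -⟩ := List.Forall₂.exists_of_mem_right htable hq
      rw [h1]; exact hQ)
    (fun Q hQ => by
      obtain ⟨q, hq, h1, -⟩ := List.Forall₂.exists_of_mem_left htable hQ
      exact ⟨q, hq, h1⟩) ((leafOne O γ S).dom \ S)
  change Q = leafTwo O γ S at hQ
  have hval : (h.eval S).val = v := by
    unfold Hypothesis.eval
    rw [Timed.val_bind, Timed.val_bind, hv]
    dsimp only
    rw [Timed.val_bind, Timed.val_bind, Timed.val_bind, Timed.val_bind]
    dsimp only
    change Timed.val (match (lookup table (locate table (groundList (leafOne O γ S))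
      ((leafOne O γ S).dom \ S)).val).val with | none => _ | some (_, v) => _) = v
    rw [hv']
  rw [hval]
  obtain ⟨Q', _, h1, h2⟩ := List.Forall₂.exists_of_mem_right htable hq
  have : Q' = leafTwo O γ S := by rw [← hQ]; exact h1.symm
  rw [← this]; exact h2

theorem lookup_cost {A : Type} (table : List (Piece U × A)) (B : Finset U) :
    (lookup table B).cost = (table.length + 1) * (Fintype.card U + 1) := rfl

theorem Hypothesis.eval_cost_le {h : Hypothesis U} {M : ℕ} (hM : 1 ≤ M) (h1 : h.length ≤ M)
    (h2 : ∀ e ∈ h, e.2.length ≤ M) (S : Finset U) :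
    (h.eval S).cost ≤ 17 * M * (Fintype.card U + 1) ^ 2 := by
  set n := Fintype.card U with hn
  have hlook : ∀ {A : Type} (table : List (Piece U × A)) (B : Finset U), table.length ≤ M →
      (lookup table B).cost ≤ (M + 1) * (n + 1) := by
    intro A table B h
    rw [lookup_cost]; exact Nat.mul_le_mul_right _ (by omega)
  have hloc : ∀ {A : Type} (table : List (Piece U × A)) (xs : List U) (S : Finset U),
      table.length ≤ M → xs.length ≤ n →
      (locate table xs S).cost ≤ n * ((M + 1) * (n + 1) + (n + 3)) := by
    intro A table xs S h hxs
    refine (locate_cost_le table xs S).trans (Nat.mul_le_mul hxs ?_)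
    exact Nat.add_le_add_right (Nat.mul_le_mul_right _ (by omega)) _
  have hsum : n * ((M + 1) * (n + 1) + (n + 3)) + ((M + 1) * (n + 1) + ((n + 1) + ((n + 1) +
      (n * ((M + 1) * (n + 1) + (n + 3)) + ((M + 1) * (n + 1) + 1))))) ≤
      17 * M * (n + 1) ^ 2 := by
    obtain ⟨k, rfl⟩ := Nat.exists_eq_add_of_le hM
    nlinarith [Nat.zero_le (k * n), Nat.zero_le (k * n ^ 2), Nat.zero_le (n ^ 2)]
  refine le_trans ?_ hsum
  unfold Hypothesis.eval
  rw [Timed.cost_bind, Timed.cost_bind]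
  refine Nat.add_le_add (hloc _ _ _ h1 length_universeList.le)
    (Nat.add_le_add (hlook _ _ h1) ?_)
  rcases hv : (lookup h (locate h (universeList U) S).val).val with _ | ⟨P, table⟩
  · dsimp only; omega
  · have hmem : (P, table) ∈ h := List.mem_of_find?_eq_some hv
    have htable := h2 _ hmem
    dsimp only
    rw [Timed.cost_bind, Timed.cost_bind, Timed.cost_bind, Timed.cost_bind]
    refine Nat.add_le_add le_rfl (Nat.add_le_add le_rfl (Nat.add_le_add
      (hloc _ _ _ htable (length_groundList_le P)) (Nat.add_le_add (hlook _ _ htable) ?_)))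
    split <;> exact le_rfl

end Output

/-! ### The learning algorithm -/

section Learn

variable {U : Type} [Fintype U] [LinearOrder U] {O f : Finset U → ℝ}

open Prog

/-- The tables of estimates for a list of pairs of pieces. -/
noncomputable def estimateAll (p : U → unitInterval) (m : ℕ)
    (G : List (Piece U × List (Piece U))) : Prog U (Hypothesis U) :=
  G.mapM (fun e => do
    let table ← e.2.mapM (fun Q => do
      let v ← estimate p m e.1 Q
      Prog.arith (Q, v))
    Prog.arith (e.1, table))

theorem prob_estimateAll_ge {p : U → unitInterval} {m : ℕ} {Acc : Piece U → Piece U → ℝ → Prop}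
    {ε : ℝ} (hε : 0 ≤ ε) (h : ∀ P Q, 1 - ε ≤ (estimate p m P Q).prob O (Acc P Q))
    (G : List (Piece U × List (Piece U))) :
    1 - ((G.map fun e => e.2.length).sum : ℕ) * ε ≤ (estimateAll p m G).prob O (Matches Acc G) := by
  have hN : ((G.map fun e => e.2.length).sum : ℕ) * ε =
      (G.map fun e => (e.2.length : ℝ) * ε).sum := by
    induction G with
    | nil => simp
    | cons e G ih => simp only [List.map_cons, List.sum_cons, Nat.cast_add, add_mul, ih]
  rw [hN]
  refine prob_mapM_ge (fun e => by positivity) fun e _ => ?_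
  rw [← add_zero ((e.2.length : ℝ) * ε)]
  refine prob_bind_ge le_rfl (Q := List.Forall₂ (fun Q q => q.1 = Q ∧ Acc e.1 Q q.2) e.2) ?_
    fun table htable => ?_
  · have hs : (e.2.length : ℝ) * ε = (e.2.map fun _ => ε).sum := by simp
    rw [hs]
    refine prob_mapM_ge (fun _ => hε) fun Q _ => ?_
    rw [← add_zero ε]
    refine prob_bind_ge le_rfl (h e.1 Q) fun v hv => ?_
    have : (Prog.arith (Q, v) : Prog U _).prob O (fun q => q.1 = Q ∧ Acc e.1 Q q.2) = 1 :=
      if_pos ⟨rfl, hv⟩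
    rw [this]; simp
  · have : (Prog.arith (e.1, table) : Prog U _).prob O (fun e' => e'.1 = e.1 ∧
        List.Forall₂ (fun Q q => q.1 = Q ∧ Acc e.1 Q q.2) e.2 e'.2) = 1 := if_pos ⟨rfl, htable⟩
    rw [this]; simp

theorem ensures_estimateAll (p : U → unitInterval) (m : ℕ) {M : ℕ}
    {G : List (Piece U × List (Piece U))} (hG : G.length ≤ M) (hM : ∀ e ∈ G, e.2.length ≤ M) :
    (estimateAll p m G).Ensures O
      (M * (M * (5 * (Fintype.card U + 1) ^ 2 * (m + 1)) + 1))
      (Matches (fun _ _ _ => True) G) := by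
  set n := Fintype.card U with hn
  refine (Ensures.mapM (t := M * (5 * (n + 1) ^ 2 * (m + 1)) + 1) fun e he => ?_).mono
    (Nat.mul_le_mul_right _ hG) fun _ h => h
  refine Ensures.bind (t₂ := 1)
    ((Ensures.mapM (t := 5 * (n + 1) ^ 2 * (m + 1)) (R := fun Q q => q.1 = Q ∧ True)
      fun Q _ => ?_).mono (Nat.mul_le_mul_right _ (hM e he)) fun _ h => h)
    (fun table htable => (ensures_arith _).mono le_rfl ?_) le_rfl
  · refine (ensures_estimate p m e.1 Q).bind (fun v _ => (ensures_arith (Q, v)).mono le_rfl ?_) ?_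
    · rintro _ rfl; exact ⟨rfl, trivial⟩
    · rw [← hn]
      nlinarith [Nat.zero_le (m * n), Nat.zero_le (m * n ^ 2), Nat.zero_le (n ^ 2)]
  · rintro _ rfl; exact ⟨rfl, htable⟩

/-- The number of pairs of pieces. -/
noncomputable def numPairs (O : Finset U → ℝ) (γ : ℝ) : ℕ :=
  ((twoStages O γ).map fun e => e.2.length).sum

theorem one_le_numPairs (O : Finset U → ℝ) (γ : ℝ) : 1 ≤ numPairs O γ := by
  have h1 : (leafOne O γ ∅, stageTwo O γ (leafOne O γ ∅)) ∈ twoStages O γ :=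
    List.mem_map_of_mem (leafOne_mem_stageOne ∅)
  have h2 : (stageTwo O γ (leafOne O γ ∅)).length ≤ numPairs O γ :=
    List.single_le_sum (fun _ _ => Nat.zero_le _) _
      (List.mem_map_of_mem (f := fun e : Piece U × List (Piece U) => e.2.length) h1)
  exact (List.length_pos_of_mem (leafIn_mem_stageTwo _ ∅)).trans_le h2

theorem numPairs_le {γ : ℝ} {M : ℕ} (h1 : (stageOne O γ).length ≤ M)
    (h2 : ∀ P, (stageTwo O γ P).length ≤ M) : numPairs O γ ≤ M * M := by
  refine (List.sum_le_card_nsmul _ M fun x hx => ?_).trans ?_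
  · simp only [twoStages, List.map_map, List.mem_map] at hx
    obtain ⟨P, _, rfl⟩ := hx
    exact h2 P
  · simp only [twoStages, List.length_map, smul_eq_mul]
    exact Nat.mul_le_mul_right _ h1

/-- The number of samples for each pair. -/
noncomputable def numSamples (α δ : ℝ) (N : ℕ) : ℕ := ⌈1250 / α ^ 2 * Real.log (2 * N / δ)⌉₊

theorem prob_learn {p : U → unitInterval} {α β δ : ℝ} {M : ℕ}
    (h1 : (stageOne O (α ^ 2 / (6 * Real.log (2 / β)))).length ≤ M)
    (h2 : ∀ P, (stageTwo O (α ^ 2 / (6 * Real.log (2 / β))) P).length ≤ M)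
    {E : Hypothesis U → Prop} :
    (learn p α β δ).prob O E =
      (estimateAll p (numSamples α δ (numPairs O (α ^ 2 / (6 * Real.log (2 / β)))))
        (twoStages O (α ^ 2 / (6 * Real.log (2 / β))))).prob O E := by
  unfold learn
  rw [prob_bind_of_ensures (ensures_arith _), prob_bind_of_ensures (ensures_decomposeTwice h1 h2)]
  rfl

theorem ensures_learn (p : U → unitInterval) {α β δ : ℝ} {M : ℕ} (hM : 1 ≤ M)
    (h1 : (stageOne O (α ^ 2 / (6 * Real.log (2 / β)))).length ≤ M)
    (h2 : ∀ P, (stageTwo O (α ^ 2 / (6 * Real.log (2 / β))) P).length ≤ M) :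
    (learn p α β δ).Ensures O (128 * M ^ 2 * (Fintype.card U + 1) ^ 2 *
        (numSamples α δ (numPairs O (α ^ 2 / (6 * Real.log (2 / β)))) + 1))
      (Matches (fun _ _ _ => True) (twoStages O (α ^ 2 / (6 * Real.log (2 / β))))) := by
  set n := Fintype.card U with hn
  set γ := α ^ 2 / (6 * Real.log (2 / β)) with hγ
  set m := numSamples α δ (numPairs O γ) with hm
  have hG : (twoStages O γ).length ≤ M := by simpa [twoStages] using h1
  have hG2 : ∀ e ∈ twoStages O γ, e.2.length ≤ M := by
    intro e he
    obtain ⟨P, _, rfl⟩ := List.mem_map.1 he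
    exact h2 P
  unfold learn
  refine (ensures_arith _).bind_eq ((ensures_decomposeTwice h1 h2).bind_eq
    (Ensures.bind_eq (t₁ := 0) (a := numPairs O γ) (Ensures.pure rfl)
      (Ensures.bind_eq (t₁ := M + M * M + 1) (a := ()) ⟨?_, fun _ _ => rfl⟩
        ((ensures_arith _).bind_eq (ensures_estimateAll p m hG hG2) le_rfl) le_rfl) le_rfl)
      le_rfl) ?_
  · have := numPairs_le h1 h2
    have h3 : (twoStages O γ).length + numPairs O γ + 1 ≤ M + M * M + 1 := by omega
    exact h3
  · rw [← hn]
    have e1 : (M + 1) * ((n + 1) * M * (16 * n + 41) + 2 * n + 2) ≤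
        86 * (M ^ 2 * (n + 1) ^ 2) := by
      obtain ⟨k, rfl⟩ := Nat.exists_eq_add_of_le hM
      nlinarith [Nat.zero_le (k * n), Nat.zero_le (k * n ^ 2), Nat.zero_le (k ^ 2 * n),
        Nat.zero_le (k ^ 2 * n ^ 2), Nat.zero_le (k ^ 2), Nat.zero_le (n ^ 2)]
    have e2 : M * (M * (5 * (n + 1) ^ 2 * (m + 1)) + 1) =
      5 * (M ^ 2 * (n + 1) ^ 2 * (m + 1)) + M := by ring
    have e3 : M ≤ M ^ 2 := by nlinarith
    have e4 : M ^ 2 ≤ M ^ 2 * (n + 1) ^ 2 := Nat.le_mul_of_pos_right _ (by positivity)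
    have e5 : M ^ 2 * (n + 1) ^ 2 ≤ M ^ 2 * (n + 1) ^ 2 * (m + 1) :=
      Nat.le_mul_of_pos_right _ (by positivity)
    have e6 : M * M = M ^ 2 := by ring
    have e7 : 1 ≤ M ^ 2 := Nat.one_le_pow _ _ hM
    have e8 : 128 * M ^ 2 * (n + 1) ^ 2 * (m + 1) = 128 * (M ^ 2 * (n + 1) ^ 2 * (m + 1)) := by
      ring
    rw [e2, e8]
    omega

theorem card_le_of_marginals {g : Finset U → ℝ} {τ : ℝ} (hτ : 0 < τ)
    (hg : ∀ S, g S ∈ Set.Icc (-τ) (1 + τ)) {B : Finset U}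
    (h : B.card * (4 * τ) ≤ g B - g ∅) : B.card ≤ ⌊1 / (4 * τ) + 1 / 2⌋₊ := by
  refine Nat.le_floor ?_
  have h1 := (hg B).2
  have h2 := (hg ∅).1
  have : (B.card : ℝ) ≤ (1 + 2 * τ) / (4 * τ) := by
    rw [le_div_iff₀ (by positivity)]; linarith
  refine this.trans (le_of_eq ?_)
  field_simp; ring

theorem length_stages_le {τ : ℝ} (hτ : 0 < τ) (hO : ∀ S, O S ∈ Set.Icc (-τ) (1 + τ)) :
    (stageOne O (12 * τ)).length ≤ (Fintype.card U + 1) ^ ⌊1 / (4 * τ) + 1 / 2⌋₊ ∧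
    ∀ P, (stageTwo O (12 * τ) P).length ≤ (Fintype.card U + 1) ^ ⌊1 / (4 * τ) + 1 / 2⌋₊ := by
  have hθ : 12 * τ / 3 = 4 * τ := by ring
  constructor
  · rw [stageOne, List.length_map, hθ]
    exact length_enumSets_le nodup_universeList fun B h => card_le_of_marginals hτ hO h
  · intro P
    rw [stageTwo, List.length_map, hθ]
    exact length_enumSets_le (nodup_groundList P) fun B h =>
      card_le_of_marginals (g := complementFn O P) hτ (fun S => hO _) h

end Learn

/-! ### Bounds on the parameters -/

theorem log_two_div_ge {β : ℝ} (hβ : 0 < β) (hβ1 : β ≤ 1) : 0.69 ≤ Real.log (2 / β) := by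
  have h : (2 : ℝ) ≤ 2 / β := by rw [le_div_iff₀ hβ]; linarith
  have := Real.log_le_log (by norm_num) h
  linarith [Real.log_two_gt_d9]

theorem numSamples_spec {α δ : ℝ} (hα : 0 < α) (hδ : 0 < δ) (hδ1 : δ ≤ 1) {N : ℕ}
    (hN : 1 ≤ N) : 0 < numSamples α δ N ∧
      2 * Real.exp (-(4 / 3 * (α / 15) ^ 2 * numSamples α δ N)) ≤ δ / N := by
  have hN' : (1 : ℝ) ≤ N := by exact_mod_cast hN
  have h2 : (2 : ℝ) ≤ 2 * N / δ := by rw [le_div_iff₀ hδ]; nlinarith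
  have hlog : 0 < Real.log (2 * N / δ) := Real.log_pos (by linarith)
  have hpos : 0 < 1250 / α ^ 2 * Real.log (2 * N / δ) := by positivity
  refine ⟨Nat.ceil_pos.2 hpos, ?_⟩
  have hle : 1250 / α ^ 2 * Real.log (2 * N / δ) ≤ numSamples α δ N := Nat.le_ceil _
  have h3 : Real.log (2 * N / δ) ≤ 4 / 3 * (α / 15) ^ 2 * numSamples α δ N := by
    have h4 := mul_le_mul_of_nonneg_left hle (by positivity : 0 ≤ 4 / 3 * (α / 15) ^ 2)
    refine le_trans ?_ h4
    have : 4 / 3 * (α / 15) ^ 2 * (1250 / α ^ 2 * Real.log (2 * N / δ)) =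
        (5000 / 675) * Real.log (2 * N / δ) := by field_simp; ring
    rw [this]; linarith
  have h5 := Real.exp_le_exp.2 (neg_le_neg h3)
  rw [Real.exp_neg (Real.log _), Real.exp_log (by linarith)] at h5
  refine (mul_le_mul_of_nonneg_left h5 (by norm_num)).trans (le_of_eq ?_)
  field_simp

theorem numSamples_le {α δ : ℝ} (hα : 0 < α) (hδ : 0 < δ) (hδ1 : δ ≤ 1) {N : ℕ}
    (hN : 1 ≤ N) : (numSamples α δ N : ℝ) + 1 ≤
      (2500 / α ^ 2 + 2) * N * (1 + Real.log (1 / δ)) := by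
  have hN' : (1 : ℝ) ≤ N := by exact_mod_cast hN
  have h2 : (2 : ℝ) ≤ 2 * N / δ := by rw [le_div_iff₀ hδ]; nlinarith
  have hlog : 0 < Real.log (2 * N / δ) := Real.log_pos (by linarith)
  have hl : 0 ≤ Real.log (1 / δ) := Real.log_nonneg (by rw [le_div_iff₀ hδ]; linarith)
  have h1 : (numSamples α δ N : ℝ) < 1250 / α ^ 2 * Real.log (2 * N / δ) + 1 :=
    Nat.ceil_lt_add_one (by positivity)
  have h3 : Real.log (2 * N / δ) ≤ 2 * N * (1 + Real.log (1 / δ)) := by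
    have : (2 : ℝ) * N / δ = 2 * N * (1 / δ) := by ring
    rw [this, Real.log_mul (by positivity) (by positivity)]
    have := Real.log_le_sub_one_of_pos (by positivity : (0 : ℝ) < 2 * N)
    nlinarith
  have h4 := mul_le_mul_of_nonneg_left h3 (by positivity : 0 ≤ 1250 / α ^ 2)
  have h5 : 1 ≤ N * (1 + Real.log (1 / δ)) := by nlinarith
  have h6 : 1250 / α ^ 2 * (2 * N * (1 + Real.log (1 / δ))) =
    2500 / α ^ 2 * N * (1 + Real.log (1 / δ)) := by ring
  rw [h6] at h4
  linarith

/-- A power of `n + 1` and constants are absorbed by a power of `n`. -/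
theorem two_pow_mul_succ_pow_le {n : ℕ} (hn : 2 ≤ n) (a b : ℕ) :
    ((2 : ℝ) ^ a * ((n : ℝ) + 1) ^ b) ≤ (n : ℝ) ^ (a + 2 * b) := by
  have hn' : (2 : ℝ) ≤ n := by exact_mod_cast hn
  rw [pow_add, pow_mul]
  gcongr
  nlinarith

theorem main_time_arith {n k m N : ℕ} {X ℓ : ℝ} (hn : 2 ≤ n) (hX : 0.69 ≤ X) (hℓ : 0 ≤ ℓ)
    (hk : (k : ℝ) ≤ 18 * X + 1 / 2) (hN : N ≤ (n + 1) ^ k * (n + 1) ^ k)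
    (hm : (m : ℝ) + 1 ≤ (4000 * X + 2) * N * (1 + ℓ)) :
    (128 * ((n : ℝ) + 1) ^ k * ((n : ℝ) + 1) ^ k * ((n : ℝ) + 1) ^ 2 * (m + 1)) ≤
      (n : ℝ) ^ (200 * X) * (1 + ℓ) := by
  have hn' : (2 : ℝ) ≤ n := by exact_mod_cast hn
  have hn0 : (0 : ℝ) < n := by linarith
  have hXn : X ≤ (n : ℝ) ^ (2 * X) := by
    have h1 : X ≤ Real.exp X := by linarith [Real.add_one_le_exp X]
    refine h1.trans ?_
    rw [Real.rpow_def_of_pos hn0]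
    refine Real.exp_le_exp.2 ?_
    have := Real.log_le_log (by norm_num) hn'
    nlinarith [Real.log_two_gt_d9]
  have hN' : (N : ℝ) ≤ ((n : ℝ) + 1) ^ (2 * k) := by
    rw [two_mul, pow_add]; exact_mod_cast hN
  have h1 : (m : ℝ) + 1 ≤ 4096 * (n : ℝ) ^ (2 * X) * ((n : ℝ) + 1) ^ (2 * k) * (1 + ℓ) * 2 := by
    refine hm.trans ?_
    have : (4000 * X + 2) ≤ 4096 * (n : ℝ) ^ (2 * X) * 2 := by linarith
    calc _ ≤ (4096 * (n : ℝ) ^ (2 * X) * 2) * ((n : ℝ) + 1) ^ (2 * k) * (1 + ℓ) := by gcongr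
      _ = _ := by ring
  calc _ ≤ 128 * ((n : ℝ) + 1) ^ k * ((n : ℝ) + 1) ^ k * ((n : ℝ) + 1) ^ 2 *
        (4096 * (n : ℝ) ^ (2 * X) * ((n : ℝ) + 1) ^ (2 * k) * (1 + ℓ) * 2) := by gcongr
    _ = (2 ^ 20 * ((n : ℝ) + 1) ^ (4 * k + 2)) * (n : ℝ) ^ (2 * X) * (1 + ℓ) := by ring
    _ ≤ (n : ℝ) ^ (20 + 2 * (4 * k + 2)) * (n : ℝ) ^ (2 * X) * (1 + ℓ) := by
      gcongr; exact two_pow_mul_succ_pow_le hn _ _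
    _ ≤ _ := by
      gcongr
      rw [← Real.rpow_natCast, ← Real.rpow_add hn0]
      refine Real.rpow_le_rpow_of_exponent_le (by linarith) ?_
      push_cast
      linarith

theorem eval_time_arith {n k : ℕ} {X : ℝ} (hn : 2 ≤ n) (hX : 0.69 ≤ X)
    (hk : (k : ℝ) ≤ 18 * X + 1 / 2) :
    17 * ((n : ℝ) + 1) ^ k * ((n : ℝ) + 1) ^ 2 ≤ (n : ℝ) ^ (200 * X) := by
  have hn' : (2 : ℝ) ≤ n := by exact_mod_cast hn
  calc _ ≤ 2 ^ 5 * ((n : ℝ) + 1) ^ k * ((n : ℝ) + 1) ^ 2 := by gcongr; norm_num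
    _ = 2 ^ 5 * ((n : ℝ) + 1) ^ (k + 2) := by ring
    _ ≤ (n : ℝ) ^ (5 + 2 * (k + 2)) := two_pow_mul_succ_pow_le hn _ _
    _ ≤ _ := by
      rw [← Real.rpow_natCast]
      refine Real.rpow_le_rpow_of_exponent_le (by linarith) ?_
      push_cast
      linarith

theorem mainTheorem1 :
    ∃ K : ℝ, 0 < K ∧
      ∀ (U : Type) [Fintype U] [LinearOrder U] (α β δ : ℝ),
        0 < α → α ≤ 1 → 0 < β → β ≤ 1 → 0 < δ → δ ≤ 1 →
        ∀ (p : U → unitInterval) (f : Finset U → ℝ),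
          (∀ S, f S ∈ Set.Icc (0 : ℝ) 1) → IsSubmodular f →
          ∀ O : Finset U → ℝ,
            (∀ S, |O S - f S| ≤ α ^ 2 / (72 * Real.log (2 / β))) →
            1 - δ ≤ (learn p α β δ).prob O
                (fun h => Approximates α β p f (fun S => (h.eval S).val)) ∧
            (2 ≤ Fintype.card U →
              ((learn p α β δ).time O : ℝ) ≤
                  (Fintype.card U : ℝ) ^ (K * (Real.log (2 / β) / α ^ 2)) *
                    (1 + Real.log (1 / δ)) ∧
              ∀ h : Hypothesis U, (learn p α β δ).CanReturn O h →
                ∀ S : Finset U, ((h.eval S).cost : ℝ) ≤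
                  (Fintype.card U : ℝ) ^ (K * (Real.log (2 / β) / α ^ 2))) := by
  refine ⟨200, by norm_num, ?_⟩
  intro U _ _ α β δ hα hα1 hβ hβ1 hδ hδ1 p f hf01 hf O hO
  have hL := log_two_div_ge hβ hβ1
  set L := Real.log (2 / β) with hLdef
  have hL0 : 0 < L := by linarith
  set τ := α ^ 2 / (72 * L) with hτdef
  have hτ : 0 < τ := by positivity
  have hγ : α ^ 2 / (6 * L) = 12 * τ := by rw [hτdef]; field_simp; norm_num
  have hO01 : ∀ S, O S ∈ Set.Icc (-τ) (1 + τ) := by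
    intro S
    have h1 := abs_le.1 (hO S)
    have h2 := hf01 S
    exact ⟨by linarith [h2.1], by linarith [h2.2]⟩
  obtain ⟨hlen1, hlen2⟩ := length_stages_le hτ hO01
  set k := ⌊1 / (4 * τ) + 1 / 2⌋₊ with hkdef
  set n := Fintype.card U with hn
  have hNpos := one_le_numPairs O (12 * τ)
  have hM : 1 ≤ (n + 1) ^ k := Nat.one_le_pow _ _ (by omega)
  have hens := ensures_learn (O := O) p (α := α) (β := β) (δ := δ) hM
    (by rw [← hLdef, hγ]; exact hlen1) (by rw [← hLdef, hγ]; exact hlen2)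
  rw [← hLdef, hγ] at hens
  constructor
  · rw [prob_learn (M := (n + 1) ^ k) (by rw [← hLdef, hγ]; exact hlen1)
      (by rw [← hLdef, hγ]; exact hlen2), ← hLdef, hγ]
    obtain ⟨hm0, hm⟩ := numSamples_spec hα hδ hδ1 hNpos
    have hN0 : (0 : ℝ) < numPairs O (12 * τ) := by exact_mod_cast hNpos
    have hest : ∀ P Q, 1 - δ / numPairs O (12 * τ) ≤
        (estimate p (numSamples α δ (numPairs O (12 * τ))) P Q).prob O
          fun v => |v - pairMean p f P Q| ≤ α / 15 + τ := by
      intro P Q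
      have := prob_estimate_ge hf01 hO p P Q hm0 (ε := α / 15) (by positivity) (by linarith)
      linarith
    have hall := prob_estimateAll_ge (by positivity) hest (twoStages O (12 * τ))
    change 1 - (numPairs O (12 * τ) : ℝ) * (δ / numPairs O (12 * τ)) ≤ _ at hall
    rw [mul_div_cancel₀ _ hN0.ne'] at hall
    refine hall.trans (Prog.prob_mono fun h hh => ?_)
    refine approximates_of_leaf hf hf01 hO hτ rfl p (t := 9 / 10 * α) (η := α / 15 + τ)
      (by positivity) (by linarith) ?_ ?_ fun S => hh.acc_eval S
    · have : τ ≤ α / 30 := by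
        rw [hτdef, div_le_div_iff₀ (by positivity) (by norm_num)]
        nlinarith
      linarith
    · have h1 : L ≤ (9 / 10 * α) ^ 2 / (36 * τ) := by
        rw [hτdef, le_div_iff₀ (by positivity)]
        have : L * (36 * (α ^ 2 / (72 * L))) = α ^ 2 / 2 := by field_simp; norm_num
        rw [this]; nlinarith [sq_nonneg α]
      have h2 := Real.exp_le_exp.2 (neg_le_neg h1)
      rw [Real.exp_neg L, hLdef, Real.exp_log (by positivity)] at h2
      refine (mul_le_mul_of_nonneg_left h2 (by norm_num)).trans (le_of_eq ?_)
      field_simp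
  · intro hn2
    set X := L / α ^ 2 with hXdef
    have hα2 : α ^ 2 ≤ 1 := by nlinarith
    have hX : 0.69 ≤ X := by
      rw [hXdef, le_div_iff₀ (by positivity)]; nlinarith
    have hk : (k : ℝ) ≤ 18 * X + 1 / 2 := by
      refine (Nat.floor_le (by positivity)).trans (le_of_eq ?_)
      rw [hτdef, hXdef]; field_simp; ring
    constructor
    · have hm := numSamples_le hα hδ hδ1 hNpos
      have hαX : 2500 / α ^ 2 ≤ 4000 * X := by
        rw [hXdef, ← mul_div_assoc]
        gcongr
        linarith
      have hl : 0 ≤ Real.log (1 / δ) := Real.log_nonneg (by rw [le_div_iff₀ hδ]; linarith)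
      have hm' : (numSamples α δ (numPairs O (12 * τ)) : ℝ) + 1 ≤
          (4000 * X + 2) * numPairs O (12 * τ) * (1 + Real.log (1 / δ)) := by
        refine hm.trans ?_
        gcongr
      have := main_time_arith hn2 hX hl hk (numPairs_le hlen1 hlen2) hm'
      refine le_trans ?_ this
      have ht : ((learn p α β δ).time O : ℝ) ≤ _ := Nat.cast_le.2 hens.1
      refine ht.trans (le_of_eq ?_)
      push_cast
      ring
    · intro h hh S
      have hmatch := hens.2 h hh
      have hcost := Hypothesis.eval_cost_le hM (h := h) ?_ ?_ S
      · refine le_trans ?_ (eval_time_arith hn2 hX hk)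
        exact_mod_cast hcost
      · rw [← hmatch.length_eq]
        simpa [twoStages] using hlen1
      · intro e he
        obtain ⟨e', he', _, h2⟩ := List.Forall₂.exists_of_mem_right hmatch he
        obtain ⟨P, _, rfl⟩ := List.mem_map.1 he'
        rw [← h2.length_eq]
        exact hlen2 P
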